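/- Let $M$ be a smooth manifold (without boundary, finite dimensional) with a smooth almost complex structure $J$. For a Riemannian metric $g$ on $M$ with Levi-Civita connection $\nabla$ write $\mathcal R_g(x,y)=\nabla_x\nabla_y-\nabla_y\nabla_x-\nabla_{[x,y]}$ for the curvature operator, $R_g(x,y,z,w)=g(\mathcal R_g(x,y)z,w)$ for the curvature tensor, and $\mathcal J_g(x)\colon y\mapsto\mathcal R_g(y,x)x$ for the Jacobi operator. If $g$ is $J$-invariant, i.e. $g(Jx,Jy)=g(x,y)$, then $(M,g,J)$ is called almost Kähler if the two form $\Omega(x,y)=g(Jx,y)$ is closed, and Kähler if $\nabla J=0$. A complex line at $P\in M$ is a real two-dimensional subspace $\pi\subset T_PM$ with $J\pi=\pi$. Let $(M,g,J)$ be almost Kähler and let $\tilde g$ be a Riemannian metric on $M$ such that $(M,\tilde g,J)$ is Kähler. Write $R=R_g$, $\tilde R=R_{\tilde g}$, $\mathcal R=\mathcal R_g$, and so on. In what follows the operators of both metrics attached to a complex line $\pi$ are evaluated at the same vector $x\in\pi$. 1. (Operators.) The following two conditions are equivalent: (a) $\mathcal R(x,Jx)=\tilde{\mathcal R}(x,Jx)$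 for every $P\in M$, every complex line $\pi\subset T_PM$ and every $x\in\pi$ with $g(x,x)=1$; (b) $\mathcal J(x)+\mathcal J(Jx)=\tilde{\mathcal J}(x)+\tilde{\mathcal J}(Jx)$ for all such $P,\pi,x$. If they hold, then $(M,g,J)$ is Kähler and $\mathcal R=\tilde{\mathcal R}$ as curvature operators, i.e. as $(1,3)$-tensors. 2. (Covariant tensors.) The following two conditions are equivalent: (a) $R(x,Jx,z,w)=\tilde R(x,Jx,z,w)$ for all $P,\pi,x$ as in 1 and all $z,w\in T_PM$; (b) $R(y,x,x,z)+R(y,Jx,Jx,z)=\tilde R(y,x,x,z)+\tilde R(y,Jx,Jx,z)$ for all $P,\pi,x$ as in 1 and all $y,z\in T_PM$. If they hold, then $(M,g,J)$ is Kähler and $R=\tilde R$ as curvature tensors, i.e. as $(0,4)$-tensors. -/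

import Mathlib

open scoped Manifold ContDiff
open Bundle

noncomputable section

namespace AlmostHermitian

/-! ### Local tensor calculus on open subsets of a finite dimensional real vector space -/

section Local

variable {E : Type*} [NormedAddCommGroup E] [NormedSpace ℝ E]

/-- The Christoffel symbol `Γ_u(v, w)` of a metric `G` (a field of bilinear forms on `E`) at `u`,
i.e. the value at `u` of `∇_v w` for constant vector fields `v`, `w`.  It is the vector with
`2 G(Γ(v, w), z) = (∂_v G)(w, z) + (∂_w G)(v, z) - (∂_z G)(v, w)` for all `z`; the inverse is that
of the isomorphism `E → E*` defined by the nondegenerate form `G u`. -/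
def christoffel (G : E → E →L[ℝ] E →L[ℝ] ℝ) (u v w : E) : E :=
  (G u).inverse ((1 / 2 : ℝ) •
    (fderiv ℝ G u v w + fderiv ℝ G u w v - ((fderiv ℝ G u).flip v).flip w))

/-- The curvature `∇_x ∇_y z - ∇_y ∇_x z - ∇_[x,y] z` at `u` of the Levi-Civita connection of
`G`, for constant vector fields `x`, `y`, `z` (so that `[x, y] = 0`). -/
def localCurvature (G : E → E →L[ℝ] E →L[ℝ] ℝ) (u x y z : E) : E :=
  (fderiv ℝ (fun a ↦ christoffel G a y z) u x + christoffel G u x (christoffel G u y z)) -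
    (fderiv ℝ (fun a ↦ christoffel G a x z) u y + christoffel G u y (christoffel G u x z))

/-- The covariant derivative `(∇_x A) y = ∇_x (A y) - A (∇_x y)` at `u` of a field of
endomorphisms `A`, for constant vector fields `x`, `y`. -/
def localCovDeriv (G : E → E →L[ℝ] E →L[ℝ] ℝ) (A : E → E →L[ℝ] E) (u x y : E) : E :=
  (fderiv ℝ (fun a ↦ A a y) u x + christoffel G u x (A u y)) - A u (christoffel G u x y)

/-- The exterior derivative `dβ(x, y, z)` at `u` of a field `β` of skew-symmetric bilinear forms,
for constant vector fields `x`, `y`, `z`. -/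
def localExtDeriv (β : E → E → E → ℝ) (u x y z : E) : ℝ :=
  fderiv ℝ (fun a ↦ β a y z) u x + fderiv ℝ (fun a ↦ β a z x) u y +
    fderiv ℝ (fun a ↦ β a x y) u z

end Local

/-! ### Riemannian metrics and almost complex structures on a manifold -/

variable {E : Type*} [NormedAddCommGroup E] [NormedSpace ℝ E]
  {M : Type*} [TopologicalSpace M] [ChartedSpace E M] [IsManifold 𝓘(ℝ, E) ∞ M]

variable (E M) in
/-- Smooth Riemannian metrics on the manifold `M` (modelled on `E`, without boundary). -/
abbrev Metric : Type _ :=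
  ContMDiffRiemannianMetric 𝓘(ℝ, E) ∞ E (TangentSpace 𝓘(ℝ, E) : M → Type _)

variable (E M) in
/-- Smooth almost complex structures on `M`. -/
structure AlmostComplex where
  /-- The endomorphism of the tangent space at a point. -/
  toFun (p : M) : TangentSpace 𝓘(ℝ, E) p →L[ℝ] TangentSpace 𝓘(ℝ, E) p
  apply_apply (p : M) (x : TangentSpace 𝓘(ℝ, E) p) : toFun p (toFun p x) = -x
  contMDiff : ContMDiff 𝓘(ℝ, E) (𝓘(ℝ, E).prod 𝓘(ℝ, E →L[ℝ] E)) ∞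
    (fun p ↦ TotalSpace.mk' (E →L[ℝ] E)
      (E := fun p : M ↦ TangentSpace 𝓘(ℝ, E) p →L[ℝ] TangentSpace 𝓘(ℝ, E) p) p (toFun p))

/-- `(M, g, J)` is an almost Hermitian manifold: `J` is unitary for `g`. -/
def IsAlmostHermitian (g : Metric E M) (J : AlmostComplex E M) : Prop :=
  ∀ (p : M) (x y : TangentSpace 𝓘(ℝ, E) p),
    g.inner p (J.toFun p x) (J.toFun p y) = g.inner p x y

/-! ### Coordinate expressions in a chart `e` -/

/-- The differential at `u ∈ e.target` of the inverse of the chart `e`. -/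
def dSymm (e : OpenPartialHomeomorph M E) (u : E) :
    E →L[ℝ] TangentSpace 𝓘(ℝ, E) (e.symm u) :=
  mfderiv 𝓘(ℝ, E) 𝓘(ℝ, E) e.symm u

/-- The differential at `p ∈ e.source` of the chart `e`. -/
def dChart (e : OpenPartialHomeomorph M E) (p : M) : TangentSpace 𝓘(ℝ, E) p →L[ℝ] E :=
  mfderiv 𝓘(ℝ, E) 𝓘(ℝ, E) e p

/-- The metric `g` read in the chart `e`. -/
def metricIn (g : Metric E M) (e : OpenPartialHomeomorph M E) (u : E) : E →L[ℝ] E →L[ℝ] ℝ :=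
  (dSymm e u).precomp ℝ ∘L g.inner (e.symm u) ∘L dSymm e u

/-- The almost complex structure `J` read in the chart `e`. -/
def complexIn (J : AlmostComplex E M) (e : OpenPartialHomeomorph M E) (u : E) : E →L[ℝ] E :=
  dChart e (e.symm u) ∘L J.toFun (e.symm u) ∘L dSymm e u

/-- The two form `Ω(x, y) = g(J x, y)` read in the chart `e`. -/
def kahlerFormIn (g : Metric E M) (J : AlmostComplex E M) (e : OpenPartialHomeomorph M E)
    (u x y : E) : ℝ :=
  g.inner (e.symm u) (J.toFun (e.symm u) (dSymm e u x)) (dSymm e u y)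

/-- `(M, g, J)` is almost Kähler: it is almost Hermitian and `dΩ = 0`, as expressed in every
chart of the atlas. -/
def IsAlmostKahler (g : Metric E M) (J : AlmostComplex E M) : Prop :=
  IsAlmostHermitian g J ∧ ∀ e ∈ atlas E M, ∀ u ∈ e.target, ∀ x y z : E,
    localExtDeriv (kahlerFormIn g J e) u x y z = 0

/-- `(M, g, J)` is Kähler: it is almost Hermitian and `∇J = 0` for the Levi-Civita connection
of `g`, as expressed in every chart of the atlas. -/
def IsKahler (g : Metric E M) (J : AlmostComplex E M) : Prop :=
  IsAlmostHermitian g J ∧ ∀ e ∈ atlas E M, ∀ u ∈ e.target, ∀ x y : E,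
    localCovDeriv (metricIn g e) (complexIn J e) u x y = 0

/-! ### Curvature -/

/-- The curvature operator `𝓡(x, y) z` of `g` on the tangent space at `p`, with
`𝓡(x, y) = ∇_x ∇_y - ∇_y ∇_x - ∇_[x,y]`; it is computed in the preferred chart at `p`. -/
def curvatureOperator (g : Metric E M) (p : M) (x y z : TangentSpace 𝓘(ℝ, E) p) :
    TangentSpace 𝓘(ℝ, E) p :=
  (dChart (chartAt E p) p).inverse
    (localCurvature (metricIn g (chartAt E p)) (chartAt E p p)
      (dChart (chartAt E p) p x) (dChart (chartAt E p) p y) (dChart (chartAt E p) p z))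

/-- The curvature tensor `R(x, y, z, w) = g(𝓡(x, y) z, w)`. -/
def curvatureTensor (g : Metric E M) (p : M) (x y z w : TangentSpace 𝓘(ℝ, E) p) : ℝ :=
  g.inner p (curvatureOperator g p x y z) w

/-- The Jacobi operator `𝓙(x) : y ↦ 𝓡(y, x) x`. -/
def jacobiOperator (g : Metric E M) (p : M) (x y : TangentSpace 𝓘(ℝ, E) p) :
    TangentSpace 𝓘(ℝ, E) p :=
  curvatureOperator g p y x x

/-- A complex line: a real two-dimensional subspace `L` of the tangent space with `J L = L`. -/
def IsComplexLine (J : AlmostComplex E M) (p : M)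
    (L : Submodule ℝ (TangentSpace 𝓘(ℝ, E) p)) : Prop :=
  Module.finrank ℝ L = 2 ∧ L.map (J.toFun p : TangentSpace 𝓘(ℝ, E) p →ₗ[ℝ] _) = L

/-- The complex curvature operator `𝓡(L) = 𝓡(x, J x)`, for `x` in the complex line `L`. -/
def complexCurvatureOperator (g : Metric E M) (J : AlmostComplex E M) (p : M)
    (x z : TangentSpace 𝓘(ℝ, E) p) : TangentSpace 𝓘(ℝ, E) p :=
  curvatureOperator g p x (J.toFun p x) z

/-- The complex Jacobi operator `𝓙(L) = 𝓙(x) + 𝓙(J x)`, for `x` in the complex line `L`. -/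
def complexJacobiOperator (g : Metric E M) (J : AlmostComplex E M) (p : M)
    (x y : TangentSpace 𝓘(ℝ, E) p) : TangentSpace 𝓘(ℝ, E) p :=
  jacobiOperator g p x y + jacobiOperator g p (J.toFun p x) y

/-- `𝓡(L) = 𝓡'(L)` for all complex lines `L`, where both operators are evaluated at the same
`g`-unit vectors `x` of `L`. -/
def SameComplexCurvatureOperator (g g' : Metric E M) (J : AlmostComplex E M) : Prop :=
  ∀ (p : M) (L : Submodule ℝ (TangentSpace 𝓘(ℝ, E) p)), IsComplexLine J p L →
    ∀ x ∈ L, g.inner p x x = 1 →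
      complexCurvatureOperator g J p x = complexCurvatureOperator g' J p x

/-- `𝓙(L) = 𝓙'(L)` for all complex lines `L`, where both operators are evaluated at the same
`g`-unit vectors `x` of `L`. -/
def SameComplexJacobiOperator (g g' : Metric E M) (J : AlmostComplex E M) : Prop :=
  ∀ (p : M) (L : Submodule ℝ (TangentSpace 𝓘(ℝ, E) p)), IsComplexLine J p L →
    ∀ x ∈ L, g.inner p x x = 1 →
      complexJacobiOperator g J p x = complexJacobiOperator g' J p x

/-- The covariant version of `SameComplexCurvatureOperator`, for the forms
`(z, w) ↦ R(x, J x, z, w)`, where each metric is used to lower indices in its own curvature. -/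
def SameComplexCurvatureForm (g g' : Metric E M) (J : AlmostComplex E M) : Prop :=
  ∀ (p : M) (L : Submodule ℝ (TangentSpace 𝓘(ℝ, E) p)), IsComplexLine J p L →
    ∀ x ∈ L, g.inner p x x = 1 → ∀ z w : TangentSpace 𝓘(ℝ, E) p,
      g.inner p (complexCurvatureOperator g J p x z) w =
        g'.inner p (complexCurvatureOperator g' J p x z) w

/-- The covariant version of `SameComplexJacobiOperator`, for the forms
`(y, z) ↦ R(y, x, x, z) + R(y, J x, J x, z)`, where each metric is used to lower indices in its
own curvature. -/
def SameComplexJacobiForm (g g' : Metric E M) (J : AlmostComplex E M) : Prop :=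
  ∀ (p : M) (L : Submodule ℝ (TangentSpace 𝓘(ℝ, E) p)), IsComplexLine J p L →
    ∀ x ∈ L, g.inner p x x = 1 → ∀ y z : TangentSpace 𝓘(ℝ, E) p,
      g.inner p (complexJacobiOperator g J p x y) z =
        g'.inner p (complexJacobiOperator g' J p x y) z

end AlmostHermitian

end

/-! Both halves of the theorem rest on one statement,
`IsAlmostKahler.curvatureTensor_eq_of_complexLine`: an almost Kähler metric whose curvature agrees
on complex lines with a tensor `T` having the symmetries of a Kähler curvature tensor is Kähler with
curvature `T`. Its hypothesis has a curvature and a Jacobi version. Each condition of the theorem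
thus forces equality of the full curvatures, which yields the companion condition at once.

The Kähler property comes from the curvature component with two arguments of type (1,0) followed by
two of type (0,1), called `grayPart`. It vanishes for `T` by `J`-invariance in the last pair. It
vanishes for the difference `D = R - T` by the first Bianchi identity combined with polarization of
either hypothesis. So it vanishes for `R`. Gray's identity for almost Kähler metrics expresses this
component through first derivatives of `J`; on the diagonal, `grayPart (x, y, x, y) = 2 |(∇_x J) y -
(∇_y J) x|²`. Its vanishing makes `g((∇_x J) y, z)` symmetric in `x, y`; being skew in `y, z`, this
trilinear form is zero.

Once `∇J = 0`, the difference `D` is itself `J`-invariant. Then `D(x, Jx) = 0` gives `D(Jx, Jy) =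
-D(x, y)` by polarization, against `D(Jx, Jy) = D(x, y)`, so `D = 0`. In the Jacobi version `D(x,
Jx) = 0` is first recovered from the Bianchi identity.

For covariant tensors `T` is the curvature tensor of the second metric. For operators `T` is the
second operator lowered with the first metric `g`, and its skewness in the last two slots is not
automatic. It is inherited from `R` on the pairs `(x, Jx)`, and these determine a Kähler curvature
operator (`IsKahler.isCurvatureLike_lower`). -/

noncomputable section

set_option maxSynthPendingDepth 3

namespace AlmostHermitian

/-! ### Algebraic curvature tensors on a complex vector space -/

section Algebra

variable {V : Type*} [AddCommGroup V]

/-- A `(0, 4)`-tensor with the symmetries of a curvature tensor. -/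
structure IsCurvatureLike (T : V → V → V → V → ℝ) : Prop where
  add_left (x x' y z w : V) : T (x + x') y z w = T x y z w + T x' y z w
  swap_left (x y z w : V) : T y x z w = -T x y z w
  swap_right (x y z w : V) : T x y w z = -T x y z w
  bianchi (x y z w : V) : T x y z w + T y z x w + T z x y w = 0

namespace IsCurvatureLike

variable {T T' : V → V → V → V → ℝ} (h : IsCurvatureLike T)

include h

/-- The classical octahedron argument: the Bianchi identities for the four rotations of `(x, y, z,
w)`, combined through skewness in each pair. -/
theorem pair_symm (x y z w : V) : T z w x y = T x y z w := by
  have b1 := h.bianchi x y z w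
  have b2 := h.bianchi y z w x
  have b3 := h.bianchi z w x y
  have b4 := h.bianchi w x y z
  have e1 := h.swap_right y z x w
  have e2 := h.swap_right z w x y
  have e3 := h.swap_right w x z y
  have e4 := h.swap_right x y w z
  have e5 := h.swap_left z x y w
  have e6 := h.swap_left y w z x
  have e7 := h.swap_right z x y w
  have e8 := h.swap_right w y x z
  have e9 := h.swap_left w y x z
  have e10 := h.swap_left x z w y
  have e11 := h.swap_right w y z x
  have e12 := h.swap_right x z w y
  grind

theorem add_snd (x y y' z w : V) : T x (y + y') z w = T x y z w + T x y' z w := by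
  rw [h.swap_left (y + y'), h.add_left, h.swap_left x y, h.swap_left x y']; ring

theorem add_trd (x y z z' w : V) : T x y (z + z') w = T x y z w + T x y z' w := by
  rw [h.pair_symm (z + z') w, h.add_left, h.pair_symm x y, h.pair_symm x y]

theorem neg_left (x y z w : V) : T (-x) y z w = -T x y z w := by
  have h0 := h.add_left 0 0 y z w
  have h1 := h.add_left x (-x) y z w
  simp only [add_neg_cancel, add_zero] at h0 h1
  linarith

theorem neg_snd (x y z w : V) : T x (-y) z w = -T x y z w := by
  linarith [h.swap_left (-y) x z w, h.neg_left y x z w, h.swap_left x y z w]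

theorem neg_trd (x y z w : V) : T x y (-z) w = -T x y z w := by
  rw [h.pair_symm (-z) w, h.neg_left, h.pair_symm x y]

theorem neg_right (x y z w : V) : T x y z (-w) = -T x y z w := by
  linarith [h.swap_right x y (-w) z, h.neg_trd x y w z, h.swap_right x y z w]

theorem sub (h' : IsCurvatureLike T') : IsCurvatureLike (fun x y z w ↦ T x y z w - T' x y z w) where
  add_left x x' y z w := by rw [h.add_left, h'.add_left]; ring
  swap_left x y z w := by rw [h.swap_left, h'.swap_left]; ring
  swap_right x y z w := by rw [h.swap_right, h'.swap_right]; ring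
  bianchi x y z w := by linarith [h.bianchi x y z w, h'.bianchi x y z w]

end IsCurvatureLike

/-! ### The curvature component in Gray's identity, and when it vanishes -/

/-- Up to a factor, the real part of the component of type `((1, 0), (1, 0), (0, 1), (0, 1))` of a
real `(0, 4)`-tensor. -/
def grayPart (J : V →+ V) (T : V → V → V → V → ℝ) (x y z w : V) : ℝ :=
  T x y z w - T (J x) (J y) z w - T x y (J z) (J w) + T (J x) (J y) (J z) (J w) +
    T (J x) y (J z) w + T (J x) y z (J w) + T x (J y) (J z) w + T x (J y) z (J w)

/-- A `(0, 4)`-tensor invariant under `J` in the last pair of variables. -/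
def IsInvariantRight (J : V →+ V) (T : V → V → V → V → ℝ) : Prop :=
  ∀ x y z w : V, T x y (J z) (J w) = T x y z w

section

variable {J : V →+ V} {T : V → V → V → V → ℝ} (hJ : ∀ x, J (J x) = -x) (h : IsCurvatureLike T)
include hJ h

omit hJ in
theorem IsInvariantRight.left (hT : IsInvariantRight J T) (x y z w : V) :
    T (J x) (J y) z w = T x y z w := by
  rw [h.pair_symm z w, hT, h.pair_symm]

theorem grayPart_eq_zero_of_invariant (hT : IsInvariantRight J T) (x y z w : V) :
    grayPart J T x y z w = 0 := by
  have h1 := hT (J x) y z (J w)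
  have h2 := hT x (J y) z (J w)
  simp only [hJ, h.neg_right] at h1 h2
  simp only [grayPart, hT x y, hT (J x) (J y)]
  linarith

/-- Polarization at `x + J y`, which `J` sends to `J x - y`. -/
theorem antiinvariant_of_apply_self_eq_zero (hT : ∀ x z w, T x (J x) z w = 0) (x y z w : V) :
    T (J x) (J y) z w = -T x y z w := by
  have h1 := hT (x + J y) z w
  simp only [map_add, hJ, h.add_left, h.add_snd, h.neg_snd, hT, h.swap_left (J x) (J y)] at h1
  have h2 := hT (J y) z w
  simp only [hJ, h.neg_snd] at h2
  linarith

/-- The hypothesis kills every component whose first pair has mixed type. In the Bianchi identity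
for `x, y` of type (1,0) and `z, w` of type (0,1), the two other terms are of that kind. The proof
is the real form of this. -/
theorem grayPart_eq_zero_of_apply_self (hT : ∀ x z w, T x (J x) z w = 0) (x y z w : V) :
    grayPart J T x y z w = 0 := by
  have a := antiinvariant_of_apply_self_eq_zero hJ h hT
  have a' : ∀ x y z w, T (J x) y z w = T x (J y) z w := fun x y z w ↦ by
    have := a x (J y) z w
    rw [hJ, h.neg_snd] at this
    linarith
  have b : ∀ x y z w, T x y (J z) (J w) = -T x y z w := fun x y z w ↦ by
    rw [h.pair_symm (J z) (J w), a, h.pair_symm]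
  have b' : ∀ x y z w, T x y (J z) w = T x y z (J w) := fun x y z w ↦ by
    rw [h.pair_symm (J z) w, a', h.pair_symm z (J w)]
  have e1 := h.bianchi x y z w
  have e2 := h.bianchi (J x) y (J z) w
  have e3 := h.bianchi (J x) (J y) z w
  have e4 := h.bianchi x (J y) (J z) w
  rw [a, a' y, b', b'] at e3
  rw [a, a' z, b', b'] at e4
  simp only [grayPart, a, b, a', b', neg_neg]
  simp only [a, a', b'] at e2 e3 e4
  linarith

/-- After polarization, exchanging two middle arguments of opposite types changes the sign. For `x,
y` of type (1,0) and `z, w` of type (0,1) this gives `T(x, z, y, w) = -T(x, y, z, w)` and `T(y, z,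
x, w) = T(x, y, z, w)`, so Bianchi reads `3 T(x, y, z, w) = 0`. -/
theorem grayPart_eq_zero_of_jacobi (hT : ∀ x y z, T y x x z + T y (J x) (J x) z = 0)
    (x y z w : V) : grayPart J T x y z w = 0 := by
  have p : ∀ a x y b, T a x y b + T a y x b + T a (J x) (J y) b + T a (J y) (J x) b = 0 := by
    intro a x y b
    have h1 := hT (x + y) a b
    simp only [map_add, h.add_snd, h.add_trd] at h1
    linarith [hT x a b, hT y a b]
  have p' : ∀ x y z b, -T x y z b + T y z x b - T (J x) y (J z) b + T y (J z) (J x) b = 0 := by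
    intro x y z b
    linarith [p y x z b, h.swap_left x y z b, h.swap_left (J x) y (J z) b]
  have q : ∀ x y z w, T x y z w - T x z y w + T y z x w = 0 := fun x y z w ↦ by
    linarith [h.bianchi x y z w, h.swap_left x z y w]
  have p1 := p x y z w
  have p2 := p (J x) (J y) z w
  have p3 := p x y (J z) (J w)
  have p4 := p (J x) y z (J w)
  have p1' := p' x y z w
  have p2' := p' (J x) (J y) z w
  have p3' := p' x y (J z) (J w)
  have p4' := p' x (J y) z (J w)
  simp only [hJ, h.neg_left, h.neg_snd, h.neg_trd] at p1 p2 p3 p4 p1' p2' p3' p4'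
  rw [grayPart]
  linarith [q x y z w, q (J x) (J y) z w, q x y (J z) (J w), q (J x) (J y) (J z) (J w),
    q (J x) y (J z) w, q (J x) y z (J w), q x (J y) (J z) w, q x (J y) z (J w)]

theorem eq_zero_of_invariant_of_apply_self (hi : IsInvariantRight J T)
    (hT : ∀ x z w, T x (J x) z w = 0) (x y z w : V) : T x y z w = 0 := by
  linarith [antiinvariant_of_apply_self_eq_zero hJ h hT x y z w, hi.left h x y z w]

/-- Invariance turns the hypothesis, with last argument `J w`, into `T(z, Jx, x, w) = T(z, x, Jx,
w)`; Bianchi for `z, Jx, x` then leaves only `T(Jx, x, z, w)`. -/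
theorem apply_self_eq_zero_of_jacobi (hi : IsInvariantRight J T)
    (hT : ∀ x y z, T y x x z + T y (J x) (J x) z = 0) (x z w : V) : T x (J x) z w = 0 := by
  have h1 := hT x z (J w)
  have h2 := h.bianchi z (J x) x w
  have h3 := hi z (J x) x w
  have h4 := hi z x (J x) w
  rw [hJ, h.neg_trd] at h4
  have h5 := h.swap_left (J x) x z w
  have h6 := h.swap_left z x (J x) w
  linarith

end

/-- The pointwise form of Gray's curvature identity for almost Kähler manifolds: `h` is the second
covariant derivative of the fundamental form, and `q` the inner product of first derivatives. -/
theorem grayPart_eq_of_hessian {J : V →+ V} {T h q : V → V → V → V → ℝ}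
    (hJ : ∀ x, J (J x) = -x)
    (h4 : ∀ v x y z, h v x y (-z) = -h v x y z)
    (cyc : ∀ v x y z, h v x y z + h v y z x + h v z x y = 0)
    (hq : ∀ v x y z, h v x (J y) z - h v x y (J z) = q v y x z + q x y v z)
    (hT : ∀ v x y z, T v x (J y) z + T v x y (J z) = h v x y z - h x v y z)
    (T3 : ∀ v x y z, T v x (-y) z = -T v x y z) (T4 : ∀ v x y z, T v x y (-z) = -T v x y z)
    (q2 : ∀ a b c d, q a (-b) c d = -q a b c d) (qs : ∀ a b c d, q c d a b = q a b c d)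
    (qJ : ∀ a b c d, q (J a) b c d = q a (J b) c d)
    (qJJ : ∀ a b c d, q (J a) b (J c) d = q a b c d) (v x y z : V) :
    grayPart J T v x y z = 2 * (q v x y z - q v x z y - q x v y z + q x v z y) := by
  have q4 : ∀ a b c d, q a b c (-d) = -q a b c d := fun a b c d ↦ by rw [qs, q2, qs]
  have qJ' : ∀ a b c d, q a b (J c) d = q a b c (J d) := fun a b c d ↦ by rw [qs, qJ, qs]
  have qJJ' : ∀ a b c d, q a (J b) c (J d) = q a b c d := fun a b c d ↦ by
    rw [← qJ, ← qJ', qJJ]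
  have qA : ∀ a b c d, q a (J b) c d = -q a b c (J d) := fun a b c d ↦ by
    rw [← qJJ' a (J b), hJ, q2]
  -- Up to a factor, the imaginary part of `h` on `v, x` of type (1,0) and `y, z` of type (0,1). The
  -- Ricci identity `hT` turns its antisymmetrization in `v, x` into the Gray part.
  let F : V → V → V → V → ℝ := fun v x y z ↦
    -h (J v) x y z - h v (J x) y z + h v x (J y) z + h v x y (J z) - h (J v) (J x) (J y) z
      - h (J v) (J x) y (J z) + h (J v) x (J y) (J z) + h v (J x) (J y) (J z)
  have e1 : F v x y z - F x v y z = -2 * grayPart J T v x y z := by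
    have := fun v x ↦ hT v x y z
    have t2 := fun v x ↦ hT v x (J y) z
    have t3 := fun v x ↦ hT v x y (J z)
    have t4 := fun v x ↦ hT v x (J y) (J z)
    simp only [hJ, T3, T4] at t2 t3 t4
    simp only [F, grayPart]
    linarith [this (J v) x, this v (J x), t2 v x, t3 v x, t2 (J v) (J x), t3 (J v) (J x),
      t4 (J v) x, t4 v (J x)]
  -- `Q` sees only mixed types in the last two slots, where `hq` makes `h` quadratic in first
  -- derivatives. Cyclicity rewrites `F`, of type (0,1) in both of these slots, through such mixed
  -- terms.
  let Q : V → V → V → V → ℝ := fun v x y z ↦ h v x (J y) z - h v x y (J z)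
  have e2 : ∀ v x y z, -F v x y z =
      Q v y z x - Q (J v) y z (J x) + Q v (J y) z (J x) + Q (J v) (J y) z x +
      (-Q v z x y - Q (J v) z x (J y) + Q v (J z) x (J y) - Q (J v) (J z) x y) := by
    intro v x y z
    simp only [F, Q, hJ, h4]
    linarith [cyc (J v) x y z, cyc v (J x) y z, cyc v x (J y) z, cyc v x y (J z),
      cyc (J v) (J x) (J y) z, cyc (J v) (J x) y (J z), cyc (J v) x (J y) (J z),
      cyc v (J x) (J y) (J z)]
  have e3 := e2 v x y z
  have e4 := e2 x v y z
  simp only [Q, hq] at e3 e4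
  simp only [qJ, qJ', qA, hJ, q4, neg_neg] at e3 e4
  linarith [qs v x y z, qs x v y z, qs v x z y, qs x v z y]

end Algebra

/-! ### Vanishing of `∇J` at a point -/

section Normed

variable {E : Type*} [NormedAddCommGroup E] [NormedSpace ℝ E]

/-- If the component of type `((1, 0), (1, 0), (0, 1), (0, 1))` of the curvature `R` of an almost
Kähler structure vanishes at a point, then so does there the derivative `C = ∇J`; here `H` is the
second covariant derivative of `J`. -/
theorem eq_zero_of_grayPart_eq_zero {G : E →L[ℝ] E →L[ℝ] ℝ} {J : E →L[ℝ] E}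
    {C : E →L[ℝ] E →L[ℝ] E} {H R : E → E → E → E}
    (hG : ∀ x y, G x y = G y x) (hpos : ∀ x, x ≠ 0 → 0 < G x x)
    (hJ : ∀ x, J (J x) = -x) (hGJ : ∀ x y, G (J x) (J y) = G x y)
    (hCJ : ∀ x y, C x (J y) = -J (C x y)) (hC : ∀ x y z, G (C x y) z = -G (C x z) y)
    (hcyc : ∀ x y z, G (C x y) z + G (C y z) x + G (C z x) y = 0)
    (hHcyc : ∀ v x y z, G (H v x y) z + G (H v y z) x + G (H v z x) y = 0)
    (hHJ : ∀ v x y, H v x (J y) + C x (C v y) + (C v (C x y) + J (H v x y)) = 0)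
    (ricci : ∀ v x y, H v x y - H x v y = R v x (J y) - J (R v x y))
    (hR : ∀ v x y, R v x (-y) = -R v x y)
    (hgray : ∀ x y, grayPart (J : E →+ E) (fun x y z w ↦ G (R x y z) w) x y x y = 0)
    (x y : E) : C x y = 0 := by
  have nondeg : ∀ x, (∀ z, G x z = 0) → x = 0 := fun x hx ↦ by
    by_contra h
    exact (hpos x h).ne' (hx x)
  have skewJ : ∀ x y, G (J x) y = -G x (J y) := fun x y ↦ by
    have := hGJ x (J y)
    simp only [hJ, map_neg] at this
    linarith
  have b1 : ∀ x y z, G (C x (J y)) z = G (C x y) (J z) := fun x y z ↦ by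
    rw [hCJ, map_neg, neg_apply, skewJ, neg_neg]
  -- The quasi-Kähler identity, from closedness of the fundamental form at four triples with `J`
  -- inserted an odd number of times.
  have CJ : ∀ x y, C (J x) y = C x (J y) := fun x y ↦ by
    refine sub_eq_zero.1 (nondeg _ fun z ↦ ?_)
    have s1 := hcyc (J x) y z
    have s2 := hcyc x (J y) z
    have s3 := hcyc x y (J z)
    have s4 := hcyc (J x) (J y) (J z)
    simp only [b1, hJ, map_neg] at s1 s2 s3 s4
    simp only [map_sub, sub_apply, b1]
    linarith
  -- Gray's identity at `(v, x, v, x)` has right-hand side twice the squared length of `C v x - C x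
  -- v`.
  have key : ∀ v x, C v x = C x v := fun v x ↦ by
    refine sub_eq_zero.1 (by_contra fun h ↦ (hpos _ h).ne' ?_)
    have := grayPart_eq_of_hessian (J := (J : E →+ E)) (T := fun x y z w ↦ G (R x y z) w)
      (h := fun v x y z ↦ G (H v x y) z) (q := fun a b c d ↦ G (C a b) (C c d)) hJ
      (by simp) hHcyc ?_ ?_ (by simp [hR]) (by simp) (by simp) (fun _ _ _ _ ↦ hG _ _)
      (fun a b c d ↦ by simp [CJ]) (fun a b c d ↦ by simp [CJ, hCJ, hGJ]) v x v x
    · rw [hgray] at this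
      simp only [map_sub, sub_apply]
      linarith
    · intro v x y z
      have e := congrArg (G · z) (hHJ v x y)
      simp only [map_add, add_apply, skewJ (H v x y), map_zero, zero_apply] at e
      have e1 := hC x (C v y) z
      have e2 := hC v (C x y) z
      simp only [AddMonoidHom.coe_coe]
      linarith [hG (C x z) (C v y), hG (C v z) (C x y)]
    · intro v x y z
      have e := congrArg (G · z) (ricci v x y)
      simp only [map_sub, sub_apply, skewJ (R v x y)] at e
      simp only [AddMonoidHom.coe_coe]
      linarith
  refine nondeg _ fun z ↦ ?_
  -- A trilinear form symmetric in its first two arguments and skew in its last two is zero.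
  have e1 := hC x y z
  have e2 := hC y z x
  have e3 := hC z x y
  rw [key x z] at e1
  rw [key y x] at e2
  rw [key z y] at e3
  linarith

end Normed

section LocalGeometry

open ContinuousLinearMap Filter Topology

variable {E : Type*} [NormedAddCommGroup E] [NormedSpace ℝ E]

/-! ### Derivatives along lines -/

/-- Tensor identities below are differentiated along lines, so that the product rule is the
one-variable `HasDerivAt.clm_apply`. -/
theorem hasDerivAt_line {F : Type*} [NormedAddCommGroup F] [NormedSpace ℝ F] {f : E → F} {u : E}
    (hf : DifferentiableAt ℝ f u) (v : E) :
    HasDerivAt (fun t : ℝ ↦ f (u + t • v)) (fderiv ℝ f u v) 0 :=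
  hf.hasFDerivAt.hasLineDerivAt v

theorem eventually_line {p : E → Prop} {u : E} (h : ∀ᶠ a in 𝓝 u, p a) (v : E) :
    ∀ᶠ t : ℝ in 𝓝 0, p (u + t • v) := by
  have : Tendsto (fun t : ℝ ↦ u + t • v) (𝓝 0) (𝓝 u) := by
    have : Continuous fun t : ℝ ↦ u + t • v := by fun_prop
    simpa using this.tendsto 0
  exact this.eventually h

theorem fderiv_apply_eq_of_line {F : Type*} [NormedAddCommGroup F] [NormedSpace ℝ F] {f : E → F}
    {u v : E} {f' : F} (hf : DifferentiableAt ℝ f u)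
    (h : HasDerivAt (fun t : ℝ ↦ f (u + t • v)) f' 0) : fderiv ℝ f u v = f' :=
  (hasDerivAt_line hf v).unique h

/-- Two expressions that agree near `u` have the same derivative along `v`. -/
theorem deriv_line_eq {F : Type*} [NormedAddCommGroup F] [NormedSpace ℝ F] {f g : E → F}
    {u v : E} {f' g' : F} (h : ∀ᶠ a in 𝓝 u, f a = g a)
    (hf : HasDerivAt (fun t : ℝ ↦ f (u + t • v)) f' 0)
    (hg : HasDerivAt (fun t : ℝ ↦ g (u + t • v)) g' 0) : f' = g' :=
  hf.unique (hg.congr_of_eventuallyEq (eventually_line h v))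

/-! ### The Levi-Civita connection -/

/-- A field of inner products of class `C ^ 2` on the open set `U`. -/
structure IsLocalMetric (U : Set E) (G : E → E →L[ℝ] E →L[ℝ] ℝ) : Prop where
  isOpen : IsOpen U
  contDiffAt : ∀ a ∈ U, ContDiffAt ℝ 2 G a
  symm : ∀ a ∈ U, ∀ x y, G a x y = G a y x
  pos : ∀ a ∈ U, ∀ x, x ≠ 0 → 0 < G a x x

theorem isInvertible_of_pos [FiniteDimensional ℝ E] {g : E →L[ℝ] E →L[ℝ] ℝ}
    (h : ∀ x, x ≠ 0 → 0 < g x x) : g.IsInvertible := by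
  have inj : Function.Injective (g : E →ₗ[ℝ] E →L[ℝ] ℝ) := by
    refine (injective_iff_map_eq_zero _).2 fun x hx ↦ by_contra fun h0 ↦ (h x h0).ne' ?_
    have : g x = 0 := hx
    simp [this]
  have fr : Module.finrank ℝ E = Module.finrank ℝ (E →L[ℝ] ℝ) := by
    rw [← (LinearMap.toContinuousLinearMap (𝕜 := ℝ) (E := E) (F' := ℝ)).finrank_eq]
    exact (Subspace.dual_finrank_eq (K := ℝ) (V := E)).symm
  exact ⟨(LinearEquiv.ofInjectiveOfFinrankEq _ inj fr).toContinuousLinearEquiv, rfl⟩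

/-- The lowered Christoffel symbols, as a trilinear map. -/
def loweredChristoffel (D : E →L[ℝ] E →L[ℝ] E →L[ℝ] ℝ) : E →L[ℝ] E →L[ℝ] E →L[ℝ] ℝ :=
  (1 / 2 : ℝ) • (D + flipₗᵢ ℝ E E (E →L[ℝ] ℝ) D -
    compL ℝ E (E →L[ℝ] E →L[ℝ] ℝ) (E →L[ℝ] E →L[ℝ] ℝ)
      ((flipₗᵢ ℝ E E ℝ).toContinuousLinearEquiv : _ →L[ℝ] _) (flipₗᵢ ℝ E E (E →L[ℝ] ℝ) D))

/-- The Christoffel symbols as a bilinear map. -/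
def christoffelL (G : E → E →L[ℝ] E →L[ℝ] ℝ) (u : E) : E →L[ℝ] E →L[ℝ] E :=
  (compL ℝ E (E →L[ℝ] ℝ) E (G u).inverse).comp (loweredChristoffel (fderiv ℝ G u))

theorem christoffelL_apply (G : E → E →L[ℝ] E →L[ℝ] ℝ) (u v w : E) :
    christoffelL G u v w = christoffel G u v w := rfl

/-- The covariant derivative of a field of endomorphisms, as a bilinear map. -/
def covDerivL (Γ : E → E →L[ℝ] E →L[ℝ] E) (A : E → E →L[ℝ] E) (u : E) : E →L[ℝ] E →L[ℝ] E :=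
  fderiv ℝ A u + (((compL ℝ E E E).flip (A u)).comp (Γ u) - (compL ℝ E E E (A u)).comp (Γ u))

theorem covDerivL_apply (Γ : E → E →L[ℝ] E →L[ℝ] E) (A : E → E →L[ℝ] E) (u x y : E) :
    covDerivL Γ A u x y = fderiv ℝ A u x y + (Γ u x (A u y) - A u (Γ u x y)) := rfl

/-- The curvature of the connection with Christoffel symbols `Γ`. -/
def connCurvature (Γ : E → E →L[ℝ] E →L[ℝ] E) (u x y z : E) : E :=
  (fderiv ℝ Γ u x y z + Γ u x (Γ u y z)) - (fderiv ℝ Γ u y x z + Γ u y (Γ u x z))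

/-- The second covariant derivative `∇²_{v, x} A` of a field of endomorphisms with first covariant
derivative `C`. -/
def hessL (Γ C : E → E →L[ℝ] E →L[ℝ] E) (u v x y : E) : E :=
  fderiv ℝ C u v x y + Γ u v (C u x y) - C u (Γ u v x) y - C u x (Γ u v y)

theorem hasDerivAt_clm_apply_const {F : Type*} [NormedAddCommGroup F] [NormedSpace ℝ F]
    {c : ℝ → E →L[ℝ] F} {c' : E →L[ℝ] F} {t : ℝ} (h : HasDerivAt c c' t) (x : E) :
    HasDerivAt (fun s ↦ c s x) (c' x) t := by
  simpa using h.clm_apply (hasDerivAt_const t x)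

theorem localCurvature_swap (G : E → E →L[ℝ] E →L[ℝ] ℝ) (u x y z : E) :
    localCurvature G u y x z = -localCurvature G u x y z := by
  simp only [localCurvature, neg_sub]

section Metric

variable {U : Set E} {G : E → E →L[ℝ] E →L[ℝ] ℝ} (hG : IsLocalMetric U G) {u : E} (hu : u ∈ U)

include hG hu

namespace IsLocalMetric

theorem eventually_mem : ∀ᶠ a in 𝓝 u, a ∈ U := hG.isOpen.mem_nhds hu

theorem differentiableAt : DifferentiableAt ℝ G u :=
  (hG.contDiffAt u hu).differentiableAt (by norm_num)

theorem contDiffAt_fderiv : ContDiffAt ℝ 1 (fderiv ℝ G) u :=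
  (hG.contDiffAt u hu).fderiv_right (by norm_num)

theorem fderiv_symm (v x y : E) : fderiv ℝ G u v x y = fderiv ℝ G u v y x :=
  deriv_line_eq (f := fun a ↦ G a x y) (g := fun a ↦ G a y x)
    ((hG.eventually_mem hu).mono fun a ha ↦ hG.symm a ha x y)
    (hasDerivAt_clm_apply_const
      (hasDerivAt_clm_apply_const (hasDerivAt_line (hG.differentiableAt hu) v) x) y)
    (hasDerivAt_clm_apply_const
      (hasDerivAt_clm_apply_const (hasDerivAt_line (hG.differentiableAt hu) v) y) x)

theorem ext_of_forall_inner {x y : E} (h : ∀ z, G u x z = G u y z) : x = y := by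
  refine sub_eq_zero.1 (by_contra fun h0 ↦ (hG.pos u hu _ h0).ne' ?_)
  rw [map_sub (G u), sub_apply, h, sub_self]

variable [FiniteDimensional ℝ E]

theorem koszul (v w z : E) : G u (christoffelL G u v w) z =
    (1 / 2 : ℝ) * (fderiv ℝ G u v w z + fderiv ℝ G u w v z - fderiv ℝ G u z v w) := by
  have : G u (christoffelL G u v w) = loweredChristoffel (fderiv ℝ G u) v w :=
    (isInvertible_of_pos (hG.pos u hu)).self_apply_inverse _
  rw [this]
  rfl

theorem christoffelL_symm (v w : E) : christoffelL G u v w = christoffelL G u w v := by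
  refine hG.ext_of_forall_inner hu fun z ↦ ?_
  rw [hG.koszul hu, hG.koszul hu, hG.fderiv_symm hu z v w]
  ring

theorem compat (v w z : E) : fderiv ℝ G u v w z =
    G u (christoffelL G u v w) z + G u w (christoffelL G u v z) := by
  rw [hG.symm u hu w, hG.koszul hu, hG.koszul hu, hG.fderiv_symm hu v z w]
  ring

/-- Uniqueness of the torsion-free metric connection, by the Koszul formula. It identifies the
connection after a change of chart. -/
theorem christoffelL_eq {B : E → E → E} (hB : ∀ v w, B v w = B w v)
    (h : ∀ v w z, fderiv ℝ G u v w z = G u (B v w) z + G u w (B v z)) (v w : E) :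
    christoffelL G u v w = B v w := by
  refine hG.ext_of_forall_inner hu fun z ↦ ?_
  rw [hG.koszul hu, h, h, h, hG.symm u hu w, hG.symm u hu v, hG.symm u hu v, hB z v, hB w v, hB z w]
  ring

set_option synthInstance.maxHeartbeats 200000 in
theorem contDiffAt_christoffelL : ContDiffAt ℝ 1 (christoffelL G) u := by
  have h1 := hG.contDiffAt_fderiv hu
  have h2 : ContDiffAt ℝ 1 (fun a ↦ (G a).inverse) u :=
    ((isInvertible_of_pos (hG.pos u hu)).contDiffAt_map_inverse).comp u
      ((hG.contDiffAt u hu).of_le (by norm_num))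
  have h3 : ContDiffAt ℝ 1 (fun a ↦ loweredChristoffel (fderiv ℝ G a)) u := by
    have h4 : ContDiffAt ℝ 1 (fun a ↦ flipₗᵢ ℝ E E (E →L[ℝ] ℝ) (fderiv ℝ G a)) u :=
      (flipₗᵢ ℝ E E (E →L[ℝ] ℝ)).contDiff.contDiffAt.comp u h1
    exact ((h1.add h4).sub (ContDiffAt.comp u
      (compL ℝ E (E →L[ℝ] E →L[ℝ] ℝ) (E →L[ℝ] E →L[ℝ] ℝ) _).contDiff.contDiffAt h4)).const_smul _
  exact (ContDiffAt.comp u (compL ℝ E (E →L[ℝ] ℝ) E).contDiff.contDiffAt h2).clm_comp h3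

theorem differentiableAt_christoffelL : DifferentiableAt ℝ (christoffelL G) u :=
  (hG.contDiffAt_christoffelL hu).differentiableAt (by norm_num)

theorem localCurvature_eq (x y z : E) :
    localCurvature G u x y z = connCurvature (christoffelL G) u x y z := by
  have : ∀ x y z, fderiv ℝ (fun a ↦ christoffel G a y z) u x =
      fderiv ℝ (christoffelL G) u x y z := fun x y z ↦ by
    have hd := hG.differentiableAt_christoffelL hu
    refine fderiv_apply_eq_of_line (f := fun a ↦ christoffelL G a y z) (by fun_prop) ?_
    exact hasDerivAt_clm_apply_const (hasDerivAt_clm_apply_const (hasDerivAt_line hd x) y) z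
  simp only [localCurvature, connCurvature, this, christoffelL_apply]

theorem fderiv_christoffelL_symm (v x y : E) :
    fderiv ℝ (christoffelL G) u v x y = fderiv ℝ (christoffelL G) u v y x :=
  have hd := hG.differentiableAt_christoffelL hu
  deriv_line_eq (f := fun a ↦ christoffelL G a x y) (g := fun a ↦ christoffelL G a y x)
    ((hG.eventually_mem hu).mono fun _ ha ↦ hG.christoffelL_symm ha x y)
    (hasDerivAt_clm_apply_const (hasDerivAt_clm_apply_const (hasDerivAt_line hd v) x) y)
    (hasDerivAt_clm_apply_const (hasDerivAt_clm_apply_const (hasDerivAt_line hd v) y) x)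

theorem localCurvature_bianchi (x y z : E) :
    localCurvature G u x y z + localCurvature G u y z x + localCurvature G u z x y = 0 := by
  simp only [hG.localCurvature_eq hu, connCurvature]
  rw [hG.fderiv_christoffelL_symm hu x z y, hG.fderiv_christoffelL_symm hu y x z,
    hG.fderiv_christoffelL_symm hu z y x, hG.christoffelL_symm hu z y,
    hG.christoffelL_symm hu x z, hG.christoffelL_symm hu y x]
  abel

theorem fderiv_fderiv (x v w z : E) : fderiv ℝ (fderiv ℝ G) u x v w z =
    (fderiv ℝ G u x (christoffelL G u v w) z + G u (fderiv ℝ (christoffelL G) u x v w) z) +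
    (fderiv ℝ G u x w (christoffelL G u v z) + G u w (fderiv ℝ (christoffelL G) u x v z)) := by
  have hd := hG.differentiableAt_christoffelL hu
  have dG := hasDerivAt_line (hG.differentiableAt hu) x
  have dΓ := hasDerivAt_clm_apply_const (hasDerivAt_line hd x) v
  have d2 := hasDerivAt_clm_apply_const (hasDerivAt_clm_apply_const (hasDerivAt_clm_apply_const
    (hasDerivAt_line ((hG.contDiffAt_fderiv hu).differentiableAt (by norm_num)) x) v) w) z
  refine deriv_line_eq (f := fun a ↦ fderiv ℝ G a v w z) ((hG.eventually_mem hu).mono fun a ha ↦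
    hG.compat ha v w z) d2 ?_
  have e1 := hasDerivAt_clm_apply_const (dG.clm_apply (hasDerivAt_clm_apply_const dΓ w)) z
  have e2 := (hasDerivAt_clm_apply_const dG w).clm_apply (hasDerivAt_clm_apply_const dΓ z)
  simpa using e1.fun_add e2

/-- Second derivatives of `G` commute. Expanding both through metric compatibility leaves exactly
the two curvature terms. -/
theorem localCurvature_skew (x y z w : E) :
    G u (localCurvature G u x y w) z = -G u (localCurvature G u x y z) w := by
  have hs : fderiv ℝ (fderiv ℝ G) u x y z w = fderiv ℝ (fderiv ℝ G) u y x z w := by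
    rw [((hG.contDiffAt u hu).isSymmSndFDerivAt (by simp)).eq]
  rw [hG.fderiv_fderiv hu, hG.fderiv_fderiv hu] at hs
  simp only [hG.compat hu] at hs
  simp only [hG.localCurvature_eq hu, connCurvature, map_sub, map_add, sub_apply, add_apply]
  have s := hG.symm u hu z
  simp only [s] at hs
  rw [hG.symm u hu (christoffelL G u y z), hG.symm u hu (christoffelL G u x z)] at hs
  linarith

theorem isCurvatureLike : IsCurvatureLike (fun x y z w ↦ G u (localCurvature G u x y z) w) where
  add_left x x' y z w := by
    simp only [hG.localCurvature_eq hu, connCurvature, map_add, add_apply, map_sub, sub_apply]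
    ring
  swap_left x y z w := by rw [localCurvature_swap, map_neg, neg_apply]
  swap_right x y z w := hG.localCurvature_skew hu x y z w
  bianchi x y z w := by
    rw [← add_apply, ← add_apply, ← map_add, ← map_add, hG.localCurvature_bianchi hu, map_zero,
      zero_apply]

end IsLocalMetric

end Metric

end LocalGeometry

/-! ### Almost Hermitian structures on open sets: first and second covariant derivatives of `J` -/

section LocalHermitian

open ContinuousLinearMap Filter Topology

variable {E : Type*} [NormedAddCommGroup E] [NormedSpace ℝ E]

/-- An almost Hermitian structure of class `C ^ 2` on the open set `U`. -/
structure IsLocalHermitian (U : Set E) (G : E → E →L[ℝ] E →L[ℝ] ℝ) (J : E → E →L[ℝ] E) : Prop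
    extends IsLocalMetric U G where
  contDiffAt_complex : ∀ a ∈ U, ContDiffAt ℝ 2 J a
  apply_apply : ∀ a ∈ U, ∀ x, J a (J a x) = -x
  unitary : ∀ a ∈ U, ∀ x y, G a (J a x) (J a y) = G a x y

namespace IsLocalHermitian

variable {U : Set E} {G : E → E →L[ℝ] E →L[ℝ] ℝ} {J : E → E →L[ℝ] E}
  (h : IsLocalHermitian U G J) {u : E} (hu : u ∈ U)

include h hu

theorem skew (x y : E) : G u (J u x) y = -G u x (J u y) := by
  have := h.unitary u hu x (J u y)
  rw [h.apply_apply u hu, map_neg] at this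
  linarith

theorem differentiableAt_complex : DifferentiableAt ℝ J u :=
  (h.contDiffAt_complex u hu).differentiableAt (by norm_num)

theorem contDiffAt_fderiv_complex : ContDiffAt ℝ 1 (fderiv ℝ J) u :=
  (h.contDiffAt_complex u hu).fderiv_right (by norm_num)

theorem hasDerivAt_complex (v x : E) :
    HasDerivAt (fun t : ℝ ↦ J (u + t • v) x) (fderiv ℝ J u v x) 0 :=
  hasDerivAt_clm_apply_const (hasDerivAt_line (h.differentiableAt_complex hu) v) x

theorem hasDerivAt_metric (v x y : E) :
    HasDerivAt (fun t : ℝ ↦ G (u + t • v) x y) (fderiv ℝ G u v x y) 0 :=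
  hasDerivAt_clm_apply_const
    (hasDerivAt_clm_apply_const (hasDerivAt_line (h.differentiableAt hu) v) x) y

theorem fderiv_complex_apply (v x : E) :
    fderiv ℝ J u v (J u x) = -J u (fderiv ℝ J u v x) := by
  have e : fderiv ℝ J u v (J u x) + J u (fderiv ℝ J u v x) = 0 := by
    refine deriv_line_eq (v := v) (f := fun a ↦ J a (J a x)) (g := fun _ ↦ -x)
      ((h.eventually_mem hu).mono fun a ha ↦ h.apply_apply a ha x) ?_ (hasDerivAt_const _ _)
    simpa using (hasDerivAt_line (h.differentiableAt_complex hu) v).clm_apply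
      (h.hasDerivAt_complex hu v x)
  exact eq_neg_of_add_eq_zero_left e

theorem fderiv_form (v x y : E) : fderiv ℝ (fun a ↦ G a (J a x) y) u v =
    fderiv ℝ G u v (J u x) y + G u (fderiv ℝ J u v x) y := by
  have d1 := h.differentiableAt hu
  have d2 := h.differentiableAt_complex hu
  refine fderiv_apply_eq_of_line (by fun_prop) ?_
  simpa using hasDerivAt_clm_apply_const
    ((hasDerivAt_line d1 v).clm_apply (h.hasDerivAt_complex hu v x)) y

theorem localCovDeriv_eq (x y : E) :
    localCovDeriv G J u x y = covDerivL (christoffelL G) J u x y := by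
  have : fderiv ℝ (fun a ↦ J a y) u x = fderiv ℝ J u x y := by
    have d2 := h.differentiableAt_complex hu
    exact fderiv_apply_eq_of_line (by fun_prop) (h.hasDerivAt_complex hu x y)
  rw [localCovDeriv, covDerivL_apply, this, ← christoffelL_apply, ← christoffelL_apply]
  abel

theorem covDerivL_complex (x y : E) : covDerivL (christoffelL G) J u x (J u y) =
    -J u (covDerivL (christoffelL G) J u x y) := by
  simp only [covDerivL_apply, h.fderiv_complex_apply hu, h.apply_apply u hu, map_add, map_sub,
    map_neg]
  abel

variable [FiniteDimensional ℝ E]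

theorem fderiv_form_eq (v x y : E) : fderiv ℝ (fun a ↦ G a (J a x) y) u v =
    G u (covDerivL (christoffelL G) J u v x) y + G u (J u (christoffelL G u v x)) y +
      G u (J u x) (christoffelL G u v y) := by
  rw [h.fderiv_form hu, h.compat hu, covDerivL_apply]
  simp only [map_add, map_sub, add_apply, sub_apply]
  ring

theorem covDerivL_skew (x y z : E) : G u (covDerivL (christoffelL G) J u x y) z =
    -G u (covDerivL (christoffelL G) J u x z) y := by
  have d1 := h.differentiableAt hu
  have d2 := h.differentiableAt_complex hu
  have dy : DifferentiableAt ℝ (fun a ↦ G a (J a y) z) u := by fun_prop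
  have dz : DifferentiableAt ℝ (fun a ↦ G a (J a z) y) u := by fun_prop
  have e : fderiv ℝ (fun a ↦ G a (J a y) z) u x = -fderiv ℝ (fun a ↦ G a (J a z) y) u x := by
    refine deriv_line_eq (f := fun a ↦ G a (J a y) z) (g := fun a ↦ -G a (J a z) y)
      ((h.eventually_mem hu).mono fun a ha ↦ ?_) (hasDerivAt_line dy x)
      (hasDerivAt_line dz x).fun_neg
    rw [h.skew ha, h.symm a ha]
  rw [h.fderiv_form_eq hu, h.fderiv_form_eq hu] at e
  have s1 := h.skew hu (christoffelL G u x y) z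
  have s2 := h.skew hu (christoffelL G u x z) y
  have s3 := h.symm u hu (J u z) (christoffelL G u x y)
  have s4 := h.symm u hu (J u y) (christoffelL G u x z)
  linarith

/-- The connection is torsion-free, so the Christoffel terms cancel in `dΩ` and partial derivatives
may be replaced by covariant ones. -/
theorem covDerivL_cyclic (x y z : E)
    (hd : localExtDeriv (fun a x y ↦ G a (J a x) y) u x y z = 0) :
    G u (covDerivL (christoffelL G) J u x y) z + G u (covDerivL (christoffelL G) J u y z) x +
      G u (covDerivL (christoffelL G) J u z x) y = 0 := by
  rw [localExtDeriv, h.fderiv_form_eq hu, h.fderiv_form_eq hu, h.fderiv_form_eq hu] at hd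
  have s1 := h.skew hu (christoffelL G u x y) z
  have s2 := h.skew hu (christoffelL G u y z) x
  have s3 := h.skew hu (christoffelL G u z x) y
  have s4 := h.symm u hu (J u z) (christoffelL G u x y)
  have s5 := h.symm u hu (J u x) (christoffelL G u y z)
  have s6 := h.symm u hu (J u y) (christoffelL G u z x)
  rw [h.christoffelL_symm hu x z, h.christoffelL_symm hu y x, h.christoffelL_symm hu z y] at hd
  linarith

theorem differentiableAt_covDerivL :
    DifferentiableAt ℝ (covDerivL (christoffelL G) J) u := by
  have d1 := (h.contDiffAt_fderiv_complex hu).differentiableAt (by norm_num)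
  have d2 := h.differentiableAt_complex hu
  have d3 := h.differentiableAt_christoffelL hu
  have d4 : DifferentiableAt ℝ (fun a ↦ (compL ℝ E E E).flip (J a)) u :=
    ((compL ℝ E E E).flip).differentiableAt.comp u d2
  have d5 : DifferentiableAt ℝ (fun a ↦ (compL ℝ E E E) (J a)) u :=
    (compL ℝ E E E).differentiableAt.comp u d2
  exact d1.add ((d4.clm_comp d3).sub (d5.clm_comp d3))

theorem hasDerivAt_covDerivL (v x y : E) :
    HasDerivAt (fun t : ℝ ↦ covDerivL (christoffelL G) J (u + t • v) x y)
      (fderiv ℝ (covDerivL (christoffelL G) J) u v x y) 0 :=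
  hasDerivAt_clm_apply_const
    (hasDerivAt_clm_apply_const (hasDerivAt_line (h.differentiableAt_covDerivL hu) v) x) y

theorem fderiv_covDerivL (v x y : E) : fderiv ℝ (covDerivL (christoffelL G) J) u v x y =
    fderiv ℝ (fderiv ℝ J) u v x y +
      (fderiv ℝ (christoffelL G) u v x (J u y) + christoffelL G u x (fderiv ℝ J u v y) -
        (fderiv ℝ J u v (christoffelL G u x y) + J u (fderiv ℝ (christoffelL G) u v x y))) := by
  refine (h.hasDerivAt_covDerivL hu v x y).unique ?_
  have d1 := hasDerivAt_clm_apply_const (hasDerivAt_clm_apply_const (hasDerivAt_line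
    ((h.contDiffAt_fderiv_complex hu).differentiableAt (by norm_num)) v) x) y
  have d2 := hasDerivAt_line (h.differentiableAt_complex hu) v
  have d3 := hasDerivAt_clm_apply_const (hasDerivAt_line (h.differentiableAt_christoffelL hu) v) x
  have e1 := d3.clm_apply (h.hasDerivAt_complex hu v y)
  have e2 := d2.clm_apply (hasDerivAt_clm_apply_const d3 y)
  simpa [covDerivL_apply] using d1.fun_add (e1.fun_sub e2)

/-- The Ricci identity for the second covariant derivative of `J`. -/
theorem ricci (v x y : E) :
    hessL (christoffelL G) (covDerivL (christoffelL G) J) u v x y -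
      hessL (christoffelL G) (covDerivL (christoffelL G) J) u x v y =
    localCurvature G u v x (J u y) - J u (localCurvature G u v x y) := by
  have hs : fderiv ℝ (fderiv ℝ J) u v x y = fderiv ℝ (fderiv ℝ J) u x v y := by
    rw [((h.contDiffAt_complex u hu).isSymmSndFDerivAt (by simp)).eq]
  rw [h.localCurvature_eq hu, h.localCurvature_eq hu]
  simp only [hessL, connCurvature, h.fderiv_covDerivL hu, hs, h.christoffelL_symm hu x v]
  simp only [covDerivL_apply, map_add, map_sub]
  abel

/-- The second covariant derivative of `J² = -1`, obtained by differentiating `(∇_x J) J = -J (∇_x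
J)` along `v`. -/
theorem hessL_complex (v x y : E) :
    hessL (christoffelL G) (covDerivL (christoffelL G) J) u v x (J u y) +
      covDerivL (christoffelL G) J u x (covDerivL (christoffelL G) J u v y) +
      (covDerivL (christoffelL G) J u v (covDerivL (christoffelL G) J u x y) +
        J u (hessL (christoffelL G) (covDerivL (christoffelL G) J) u v x y)) = 0 := by
  set C := covDerivL (christoffelL G) J
  have e : fderiv ℝ C u v x (J u y) + C u x (fderiv ℝ J u v y) =
      -(fderiv ℝ J u v (C u x y) + J u (fderiv ℝ C u v x y)) := by
    refine deriv_line_eq (v := v) (f := fun a ↦ C a x (J a y)) (g := fun a ↦ -J a (C a x y))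
      ((h.eventually_mem hu).mono fun a ha ↦ h.covDerivL_complex ha x y) ?_ ?_
    · simpa using (hasDerivAt_clm_apply_const
        (hasDerivAt_line (h.differentiableAt_covDerivL hu) v) x).clm_apply
        (h.hasDerivAt_complex hu v y)
    · simpa using ((hasDerivAt_line (h.differentiableAt_complex hu) v).clm_apply
        (h.hasDerivAt_covDerivL hu v x y)).fun_neg
  have c1 : ∀ x y, C u x (J u y) = -J u (C u x y) := h.covDerivL_complex hu
  have e1 : ∀ z, C u v z = fderiv ℝ J u v z + (christoffelL G u v (J u z) -
    J u (christoffelL G u v z)) := fun z ↦ rfl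
  rw [hessL, hessL, e1 y, e1 (C u x y), eq_sub_of_add_eq e, c1, c1]
  simp only [map_add, map_sub, map_neg, c1]
  abel

/-- The covariant derivative of the cyclic identity for `∇J`; this is where closedness is needed on
a neighbourhood. -/
theorem hessL_cyclic (hd : ∀ a ∈ U, ∀ x y z, localExtDeriv (fun a x y ↦ G a (J a x) y) a x y z = 0)
    (v x y z : E) :
    G u (hessL (christoffelL G) (covDerivL (christoffelL G) J) u v x y) z +
      G u (hessL (christoffelL G) (covDerivL (christoffelL G) J) u v y z) x +
      G u (hessL (christoffelL G) (covDerivL (christoffelL G) J) u v z x) y = 0 := by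
  have cyc : ∀ a ∈ U, ∀ x y z, _ := fun a ha x y z ↦ h.covDerivL_cyclic ha x y z (hd a ha x y z)
  have cyc0 := cyc u hu
  have skw := h.covDerivL_skew hu
  have D := h.hasDerivAt_covDerivL hu v
  set C := covDerivL (christoffelL G) J
  have d : ∀ x y z, HasDerivAt (fun t : ℝ ↦ G (u + t • v) (C (u + t • v) x y) z)
      (fderiv ℝ G u v (C u x y) z + G u (fderiv ℝ C u v x y) z) 0 := fun x y z ↦ by
    simpa using hasDerivAt_clm_apply_const ((hasDerivAt_line (h.differentiableAt hu) v).clm_apply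
      (D x y)) z
  have e := deriv_line_eq (f := fun a ↦ G a (C a x y) z + G a (C a y z) x + G a (C a z x) y)
    (g := fun _ ↦ 0) ((h.eventually_mem hu).mono fun a ha ↦ cyc a ha x y z)
    (((d x y z).fun_add (d y z x)).fun_add (d z x y)) (hasDerivAt_const _ _)
  simp only [h.compat hu] at e
  simp only [hessL, map_add, map_sub, add_apply, sub_apply]
  linarith [cyc0 (christoffelL G u v x) y z, cyc0 x (christoffelL G u v y) z,
    cyc0 x y (christoffelL G u v z)]

/-- On an almost Kähler manifold `∇J` vanishes wherever the component of type
`((1, 0), (1, 0), (0, 1), (0, 1))` of the curvature does. -/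
theorem localCovDeriv_eq_zero
    (hd : ∀ a ∈ U, ∀ x y z, localExtDeriv (fun a x y ↦ G a (J a x) y) a x y z = 0)
    (hgray : ∀ x y, grayPart (J u : E →+ E)
      (fun x y z w ↦ G u (localCurvature G u x y z) w) x y x y = 0) (x y : E) :
    localCovDeriv G J u x y = 0 := by
  rw [h.localCovDeriv_eq hu]
  refine eq_zero_of_grayPart_eq_zero (h.symm u hu) (h.pos u hu) (h.apply_apply u hu)
    (h.unitary u hu) (h.covDerivL_complex hu) (h.covDerivL_skew hu)
    (fun x y z ↦ h.covDerivL_cyclic hu x y z (hd u hu x y z)) (h.hessL_cyclic hu hd)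
    (h.hessL_complex hu) (h.ricci hu) (fun v x y ↦ ?_) hgray x y
  simp only [h.localCurvature_eq hu, connCurvature, map_neg]
  abel

/-- If `∇J` vanishes on `U`, so does its derivative, and the Ricci identity says that the curvature
commutes with `J`. -/
theorem localCurvature_complex (hC : ∀ a ∈ U, ∀ x y, localCovDeriv G J a x y = 0) (x y z : E) :
    localCurvature G u x y (J u z) = J u (localCurvature G u x y z) := by
  have c0 : ∀ a ∈ U, ∀ x y, covDerivL (christoffelL G) J a x y = 0 := fun a ha x y ↦ by
    rw [← h.localCovDeriv_eq ha, hC a ha]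
  have f0 : ∀ v x y, fderiv ℝ (covDerivL (christoffelL G) J) u v x y = 0 := fun v x y ↦
    deriv_line_eq (g := fun _ ↦ (0 : E)) (f := fun a ↦ covDerivL (christoffelL G) J a x y)
      ((h.eventually_mem hu).mono fun a ha ↦ c0 a ha x y) (h.hasDerivAt_covDerivL hu v x y)
      (hasDerivAt_const _ _)
  refine sub_eq_zero.1 ?_
  rw [← h.ricci hu]
  simp [hessL, c0 u hu, f0]

end IsLocalHermitian

end LocalHermitian

/-! ### Metrics and almost complex structures read in a chart -/

section Charts

open Filter Topology

variable {E : Type*} [NormedAddCommGroup E] [NormedSpace ℝ E]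
  {M : Type*} [TopologicalSpace M] [ChartedSpace E M] [IsManifold 𝓘(ℝ, E) ∞ M]

variable {e : OpenPartialHomeomorph M E}

theorem metricIn_apply (g : Metric E M) (u x y : E) :
    metricIn g e u x y = g.inner (e.symm u) (dSymm e u x) (dSymm e u y) := rfl

theorem complexIn_apply (J : AlmostComplex E M) (u x : E) :
    complexIn J e u x = dChart e (e.symm u) (J.toFun (e.symm u) (dSymm e u x)) := rfl

variable (he : e ∈ atlas E M)

include he

theorem mdifferentiable_chart : e.MDifferentiable 𝓘(ℝ, E) 𝓘(ℝ, E) :=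
  mdifferentiable_of_mem_atlas he

theorem dChart_dSymm {u : E} (hu : u ∈ e.target) (x : E) :
    dChart e (e.symm u) (dSymm e u x) = x :=
  DFunLike.congr_fun ((mdifferentiable_chart he).comp_symm_deriv hu) x

theorem dSymm_dChart {p : M} (hp : p ∈ e.source) (x : TangentSpace 𝓘(ℝ, E) p) :
    (show TangentSpace 𝓘(ℝ, E) p from dSymm e (e p) (dChart e p x)) = x :=
  DFunLike.congr_fun ((mdifferentiable_chart he).symm_comp_deriv hp) x

theorem dSymm_dChart_symm {u : E} (hu : u ∈ e.target) (x : TangentSpace 𝓘(ℝ, E) (e.symm u)) :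
    dSymm e u (dChart e (e.symm u) x) = x := by
  have := dSymm_dChart he (e.map_target hu) x
  rw [e.right_inv hu] at this
  exact this

theorem dSymm_complexIn (J : AlmostComplex E M) {u : E} (hu : u ∈ e.target) (x : E) :
    dSymm e u (complexIn J e u x) = J.toFun (e.symm u) (dSymm e u x) :=
  dSymm_dChart_symm he hu _

theorem contMDiffOn_dSymm (x : E) :
    ContMDiffOn 𝓘(ℝ, E) 𝓘(ℝ, E).tangent 2
      (fun a ↦ (TotalSpace.mk' E (e.symm a) (dSymm e a x) : TangentBundle 𝓘(ℝ, E) M))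
      e.target := by
  have h1 : ContMDiffOn 𝓘(ℝ, E) 𝓘(ℝ, E) 3 e.symm e.target :=
    contMDiffOn_symm_of_mem_maximalAtlas (IsManifold.subset_maximalAtlas he)
  have h2 := h1.contMDiffOn_tangentMapWithin (m := 2) (by norm_num) e.open_target.uniqueMDiffOn
  have h3 : ContMDiff 𝓘(ℝ, E) 𝓘(ℝ, E).tangent 2
      (fun a : E ↦ (TotalSpace.mk' E a x : TangentBundle 𝓘(ℝ, E) E)) :=
    contMDiff_vectorSpace_iff_contDiff.2 contDiff_const
  refine (h2.comp h3.contMDiffOn fun a ha ↦ ha).congr fun a ha ↦ ?_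
  simp only [Function.comp, tangentMapWithin, mfderivWithin_of_isOpen e.open_target ha]
  rfl

theorem contMDiffOn_dChart :
    ContMDiffOn 𝓘(ℝ, E).tangent 𝓘(ℝ, E) 2
      (fun v : TangentBundle 𝓘(ℝ, E) M ↦ (dChart e v.1 v.2 : E))
      (TotalSpace.proj ⁻¹' e.source) := by
  have h1 : ContMDiffOn 𝓘(ℝ, E) 𝓘(ℝ, E) 3 e e.source :=
    contMDiffOn_of_mem_maximalAtlas (IsManifold.subset_maximalAtlas he)
  have h2 := h1.contMDiffOn_tangentMapWithin (m := 2) (by norm_num) e.open_source.uniqueMDiffOn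
  refine ((contMDiff_snd_tangentBundle_modelSpace E 𝓘(ℝ, E)).comp_contMDiffOn h2).congr
    fun v hv ↦ ?_
  simp only [Function.comp, tangentMapWithin, mfderivWithin_of_isOpen e.open_source hv]
  rfl

variable [FiniteDimensional ℝ E]

theorem contDiffOn_metricIn (g : Metric E M) : ContDiffOn ℝ 2 (metricIn g e) e.target := by
  refine contDiffOn_clm_apply.2 fun x ↦ contDiffOn_clm_apply.2 fun y ↦ ?_
  have h1 : ContMDiffOn 𝓘(ℝ, E) 𝓘(ℝ, E) 2 e.symm e.target :=
    contMDiffOn_symm_of_mem_maximalAtlas (IsManifold.subset_maximalAtlas he)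
  have h2 := (g.contMDiff.of_le ENat.LEInfty.out).comp_contMDiffOn h1
  intro a ha
  have : ContMDiffWithinAt 𝓘(ℝ, E) (𝓘(ℝ, E).prod 𝓘(ℝ)) 2
      (fun m ↦ TotalSpace.mk' ℝ (E := Bundle.Trivial M ℝ) (e.symm m)
        (g.inner (e.symm m) (dSymm e m x) (dSymm e m y))) e.target a :=
    ContMDiffWithinAt.clm_bundle_apply₂ (F₁ := E) (F₂ := E) (h2 a ha)
      (contMDiffOn_dSymm he x a ha) (contMDiffOn_dSymm he y a ha)
  simp only [contMDiffWithinAt_totalSpace] at this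
  exact this.2.contDiffWithinAt

theorem contDiffOn_complexIn (J : AlmostComplex E M) :
    ContDiffOn ℝ 2 (complexIn J e) e.target := by
  refine contDiffOn_clm_apply.2 fun x ↦ ?_
  have h1 : ContMDiffOn 𝓘(ℝ, E) 𝓘(ℝ, E) 2 e.symm e.target :=
    contMDiffOn_symm_of_mem_maximalAtlas (IsManifold.subset_maximalAtlas he)
  have h2 := (J.contMDiff.of_le ENat.LEInfty.out).comp_contMDiffOn h1
  have h3 : ContMDiffOn 𝓘(ℝ, E) 𝓘(ℝ, E).tangent 2
      (fun a ↦ (TotalSpace.mk' E (e.symm a) (J.toFun (e.symm a) (dSymm e a x)) :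
        TangentBundle 𝓘(ℝ, E) M)) e.target := fun a ha ↦
    ContMDiffWithinAt.clm_bundle_apply (F₁ := E) (F₂ := E) (h2 a ha)
      (contMDiffOn_dSymm he x a ha)
  exact ((contMDiffOn_dChart he).comp h3 fun a ha ↦ e.map_target ha).contDiffOn

theorem isLocalMetric_chart (g : Metric E M) : IsLocalMetric e.target (metricIn g e) where
  isOpen := e.open_target
  contDiffAt a ha := (contDiffOn_metricIn he g).contDiffAt (e.open_target.mem_nhds ha)
  symm a _ x y := g.symm _ _ _
  pos a ha x hx := g.pos _ _ fun h0 ↦ hx <| by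
    have := dChart_dSymm he ha x
    rw [← this]
    exact (congrArg (dChart e (e.symm a)) h0).trans (map_zero _)

theorem isLocalHermitian_chart (g : Metric E M) (J : AlmostComplex E M)
    (h : IsAlmostHermitian g J) : IsLocalHermitian e.target (metricIn g e) (complexIn J e) where
  toIsLocalMetric := isLocalMetric_chart he g
  contDiffAt_complex a ha := (contDiffOn_complexIn he J).contDiffAt (e.open_target.mem_nhds ha)
  apply_apply a ha x := by
    rw [complexIn_apply, dSymm_complexIn he J ha, J.apply_apply, map_neg, dChart_dSymm he ha]
  unitary a ha x y := by
    rw [metricIn_apply, dSymm_complexIn he J ha, dSymm_complexIn he J ha, h, metricIn_apply]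

end Charts

/-! ### Naturality of `∇J` -/

section ChartChange

open Filter Topology

variable {E : Type*} [NormedAddCommGroup E] [NormedSpace ℝ E] [FiniteDimensional ℝ E]

/-- The covariant derivative of `J` is natural under local diffeomorphisms `φ`. -/
theorem IsLocalHermitian.fderiv_localCovDeriv {U U' : Set E} {G G' : E → E →L[ℝ] E →L[ℝ] ℝ}
    {J J' : E → E →L[ℝ] E} (h : IsLocalHermitian U G J) (h' : IsLocalHermitian U' G' J')
    {φ : E → E} {u : E} (hu : u ∈ U) (hu' : φ u ∈ U') (hφ : ContDiffAt ℝ 2 φ u)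
    (hG : ∀ᶠ a in 𝓝 u, ∀ x y, G a x y = G' (φ a) (fderiv ℝ φ a x) (fderiv ℝ φ a y))
    (hJ : ∀ᶠ a in 𝓝 u, ∀ x, fderiv ℝ φ a (J a x) = J' (φ a) (fderiv ℝ φ a x)) (x y : E) :
    fderiv ℝ φ u (localCovDeriv G J u x y) =
      localCovDeriv G' J' (φ u) (fderiv ℝ φ u x) (fderiv ℝ φ u y) := by
  set L := fderiv ℝ φ u with hL
  -- A vector in the kernel of the differential would have length zero for the pulled-back metric
  -- `G`.
  have inj : Function.Injective L := (injective_iff_map_eq_zero L).2 fun z hz ↦ by_contra fun h0 ↦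
    (h.pos u hu z h0).ne' (by rw [hG.self_of_nhds, ← hL, hz, map_zero])
  have surj : Function.Surjective L :=
    (LinearMap.injective_iff_surjective (f := (L : E →ₗ[ℝ] E))).1 inj
  have d1 : DifferentiableAt ℝ φ u := hφ.differentiableAt (by norm_num)
  have d2 : DifferentiableAt ℝ (fderiv ℝ φ) u :=
    (hφ.fderiv_right (m := 1) (by norm_num)).differentiableAt (by norm_num)
  have D2 := fun v x ↦ hasDerivAt_clm_apply_const (hasDerivAt_line d2 v) x
  have DG : ∀ v, HasDerivAt (fun t : ℝ ↦ G' (φ (u + t • v))) (fderiv ℝ G' (φ u) (L v)) 0 :=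
    fun v ↦ HasFDerivAt.comp_hasDerivAt_of_eq (x := (0 : ℝ)) (h'.differentiableAt hu').hasFDerivAt
      (hasDerivAt_line d1 v) (by simp)
  have DJ : ∀ v, HasDerivAt (fun t : ℝ ↦ J' (φ (u + t • v))) (fderiv ℝ J' (φ u) (L v)) 0 :=
    fun v ↦ HasFDerivAt.comp_hasDerivAt_of_eq (x := (0 : ℝ))
      (h'.differentiableAt_complex hu').hasFDerivAt (hasDerivAt_line d1 v) (by simp)
  -- `B` is the candidate dictated by the transformation law of Christoffel symbols; being symmetric
  -- and compatible with `G`, it is the Levi-Civita connection.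
  choose B hB using fun v w ↦ surj (christoffelL G' (φ u) (L v) (L w) + fderiv ℝ (fderiv ℝ φ) u v w)
  have sB : ∀ v w, B v w = B w v := fun v w ↦ inj <| by
    rw [hB, hB, h'.christoffelL_symm hu', (hφ.isSymmSndFDerivAt (by simp)).eq v w]
  have eΓ : ∀ v w, L (christoffelL G u v w) =
      christoffelL G' (φ u) (L v) (L w) + fderiv ℝ (fderiv ℝ φ) u v w := fun v w ↦ by
    rw [h.christoffelL_eq hu sB (fun v w z ↦ ?_), hB]
    have e : fderiv ℝ G u v w z = fderiv ℝ G' (φ u) (L v) (L w) (L z) +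
        G' (φ u) (fderiv ℝ (fderiv ℝ φ) u v w) (L z) +
          G' (φ u) (L w) (fderiv ℝ (fderiv ℝ φ) u v z) := by
      refine deriv_line_eq (v := v) (f := fun a ↦ G a w z)
        (hG.mono fun a ha ↦ ha w z) (h.hasDerivAt_metric hu v w z) ?_
      simpa using ((DG v).clm_apply (D2 v w)).clm_apply (D2 v z)
    have g0 := hG.self_of_nhds
    rw [e, h'.compat hu', g0, g0, ← hL, hB, hB]
    simp only [map_add, add_apply]
    ring
  have eJ : fderiv ℝ (fderiv ℝ φ) u x (J u y) + L (fderiv ℝ J u x y) =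
      fderiv ℝ J' (φ u) (L x) (L y) + J' (φ u) (fderiv ℝ (fderiv ℝ φ) u x y) := by
    refine deriv_line_eq (v := x) (f := fun a ↦ fderiv ℝ φ a (J a y)) (hJ.mono fun a ha ↦ ha y)
      ?_ ?_
    · simpa using (hasDerivAt_line d2 x).clm_apply (h.hasDerivAt_complex hu x y)
    · simpa using (DJ x).clm_apply (D2 x y)
  have j0 := hJ.self_of_nhds
  rw [← hL] at j0
  rw [h.localCovDeriv_eq hu, h'.localCovDeriv_eq hu', covDerivL_apply, covDerivL_apply, map_add,
    map_sub, j0, eΓ, eΓ, j0, eq_sub_of_add_eq' eJ, map_add]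
  abel

end ChartChange

/-! ### Passing between charts and tangent spaces -/

section Manifold

open Filter Topology

variable {E : Type*} [NormedAddCommGroup E] [NormedSpace ℝ E]
  {M : Type*} [TopologicalSpace M] [ChartedSpace E M] [IsManifold 𝓘(ℝ, E) ∞ M]

section Chart

variable {e : OpenPartialHomeomorph M E} (he : e ∈ atlas E M)

include he

theorem metricIn_dChart (g : Metric E M) {p : M} (hp : p ∈ e.source)
    (x y : TangentSpace 𝓘(ℝ, E) p) :
    metricIn g e (e p) (dChart e p x) (dChart e p y) = g.inner p x y := by
  have h1 := dSymm_dChart he hp x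
  have h2 := dSymm_dChart he hp y
  rw [metricIn_apply]
  -- All tangent spaces unfold to `E`; forgetting the base point in the types allows rewriting
  -- `e.symm (e p)` to `p`.
  let gi : M → E →L[ℝ] E →L[ℝ] ℝ := fun q ↦ g.inner q
  change gi (e.symm (e p)) (dSymm e (e p) (dChart e p x)) (dSymm e (e p) (dChart e p y)) = gi p x y
  rw [e.left_inv hp]
  exact congrArg₂ (fun a b ↦ gi p a b) h1 h2

theorem complexIn_dChart (J : AlmostComplex E M) {p : M} (hp : p ∈ e.source)
    (x : TangentSpace 𝓘(ℝ, E) p) :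
    complexIn J e (e p) (dChart e p x) = dChart e p (J.toFun p x) := by
  have h1 := dSymm_dChart he hp x
  rw [complexIn_apply]
  let Ji : M → E →L[ℝ] E := fun q ↦ J.toFun q
  let di : M → E →L[ℝ] E := fun q ↦ dChart e q
  change di (e.symm (e p)) (Ji (e.symm (e p)) (dSymm e (e p) (dChart e p x))) = di p (Ji p x)
  rw [e.left_inv hp]
  exact congrArg (fun a ↦ di p (Ji p a)) h1

theorem dChart_isInvertible {p : M} (hp : p ∈ e.source) : (dChart e p).IsInvertible :=
  ⟨(mdifferentiable_chart he).mfderiv hp, rfl⟩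

theorem contMDiffAt_chart {p : M} (hp : p ∈ e.source) :
    ContMDiffAt 𝓘(ℝ, E) 𝓘(ℝ, E) 2 e p :=
  contMDiffAt_of_mem_maximalAtlas (IsManifold.subset_maximalAtlas he) hp

variable {e' : OpenPartialHomeomorph M E} (he' : e' ∈ atlas E M)

include he'

theorem contDiffAt_transition {u : E} (hu : u ∈ e.target) (hu' : e.symm u ∈ e'.source) :
    ContDiffAt ℝ 2 (e' ∘ e.symm) u :=
  (ContMDiffAt.comp u (contMDiffAt_chart he' hu') (contMDiffAt_symm_of_mem_maximalAtlas
    (IsManifold.subset_maximalAtlas he) hu)).contDiffAt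

theorem fderiv_transition {u : E} (hu : u ∈ e.target) (hu' : e.symm u ∈ e'.source) (x : E) :
    fderiv ℝ (e' ∘ e.symm) u x = dChart e' (e.symm u) (dSymm e u x) := by
  rw [← mfderiv_eq_fderiv]
  rw [mfderiv_comp u ((mdifferentiable_chart he').mdifferentiableAt hu')
    ((mdifferentiable_chart he).mdifferentiableAt_symm hu)]
  rfl

/-- Curvature is computed in the preferred chart at a point, whereas `IsKahler` refers to every
chart of the atlas; this bridges the two. -/
theorem localCovDeriv_transition [FiniteDimensional ℝ E] {g : Metric E M} {J : AlmostComplex E M}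
    (h : IsAlmostHermitian g J) {u : E} (hu : u ∈ e.target) (hu' : e.symm u ∈ e'.source)
    (h0 : ∀ x y, localCovDeriv (metricIn g e') (complexIn J e') (e' (e.symm u)) x y = 0) (x y : E) :
    localCovDeriv (metricIn g e) (complexIn J e) u x y = 0 := by
  have hV : ∀ᶠ a in 𝓝 u, a ∈ e.target ∧ e.symm a ∈ e'.source :=
    (e.open_target.eventually_mem hu).and ((e.continuousAt_symm hu).eventually
      (e'.open_source.eventually_mem hu'))
  have key := (isLocalHermitian_chart he g J h).fderiv_localCovDeriv
    (isLocalHermitian_chart he' g J h) (φ := e' ∘ e.symm) hu (e'.map_source hu')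
    (contDiffAt_transition he he' hu hu') (hV.mono fun a ha x y ↦ ?_) (hV.mono fun a ha x ↦ ?_) x y
  · rw [Function.comp_apply, h0, fderiv_transition he he' hu hu'] at key
    have k2 := (dChart_isInvertible he' hu').injective (key.trans (map_zero _).symm)
    have k3 := dChart_dSymm he hu (localCovDeriv (metricIn g e) (complexIn J e) u x y)
    rw [← k3, k2, map_zero]
  · rw [fderiv_transition he he' ha.1 ha.2, fderiv_transition he he' ha.1 ha.2,
      Function.comp_apply, metricIn_dChart he' g ha.2, metricIn_apply]
  · rw [fderiv_transition he he' ha.1 ha.2, fderiv_transition he he' ha.1 ha.2,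
      Function.comp_apply, complexIn_dChart he' J ha.2, dSymm_complexIn he J ha.1]

end Chart

end Manifold

/-! ### Curvature on the manifold and the Kähler criterion -/

section Curvature

open Filter Topology

variable {E : Type*} [NormedAddCommGroup E] [NormedSpace ℝ E]
  {M : Type*} [TopologicalSpace M] [ChartedSpace E M] [IsManifold 𝓘(ℝ, E) ∞ M]

theorem localExtDeriv_congr {U : Set E} (hU : IsOpen U) {u : E} (hu : u ∈ U) {β γ : E → E → E → ℝ}
    (h : ∀ a ∈ U, ∀ x y, β a x y = γ a x y) (x y z : E) :
    localExtDeriv β u x y z = localExtDeriv γ u x y z := by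
  have : ∀ x y, fderiv ℝ (fun a ↦ β a x y) u = fderiv ℝ (fun a ↦ γ a x y) u := fun x y ↦
    Filter.EventuallyEq.fderiv_eq ((hU.eventually_mem hu).mono fun a ha ↦ h a ha x y)
  simp only [localExtDeriv, this]

variable (g : Metric E M) {J : AlmostComplex E M} {p : M}

theorem kahlerFormIn_eq {e : OpenPartialHomeomorph M E} (he : e ∈ atlas E M) {u : E}
    (hu : u ∈ e.target) (x y : E) :
    kahlerFormIn g J e u x y = metricIn g e u (complexIn J e u x) y := by
  rw [metricIn_apply, dSymm_complexIn he J hu]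
  rfl

theorem dChart_curvatureOperator (x y z : TangentSpace 𝓘(ℝ, E) p) :
    dChart (chartAt E p) p (curvatureOperator g p x y z) =
      localCurvature (metricIn g (chartAt E p)) (chartAt E p p)
        (dChart (chartAt E p) p x) (dChart (chartAt E p) p y) (dChart (chartAt E p) p z) :=
  (dChart_isInvertible (chart_mem_atlas E p) (mem_chart_source E p)).self_apply_inverse _

theorem eq_of_forall_inner {x y : TangentSpace 𝓘(ℝ, E) p}
    (h : ∀ z, g.inner p x z = g.inner p y z) : x = y := by
  refine sub_eq_zero.1 (by_contra fun h0 ↦ (g.pos p _ h0).ne' ?_)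
  rw [map_sub (g.inner p), sub_apply, h, sub_self]

theorem curvatureTensor_eq (x y z w : TangentSpace 𝓘(ℝ, E) p) :
    curvatureTensor g p x y z w = metricIn g (chartAt E p) (chartAt E p p)
      (localCurvature (metricIn g (chartAt E p)) (chartAt E p p)
        (dChart (chartAt E p) p x) (dChart (chartAt E p) p y) (dChart (chartAt E p) p z))
      (dChart (chartAt E p) p w) := by
  rw [curvatureTensor, ← metricIn_dChart (chart_mem_atlas E p) g (mem_chart_source E p),
    dChart_curvatureOperator]

variable [FiniteDimensional ℝ E]

theorem isCurvatureLike_localCurvature (p : M) :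
    IsCurvatureLike (fun x y z w ↦ metricIn g (chartAt E p) (chartAt E p p)
      (localCurvature (metricIn g (chartAt E p)) (chartAt E p p) x y z) w) :=
  (isLocalMetric_chart (chart_mem_atlas E p) g).isCurvatureLike (mem_chart_target E p)

theorem isCurvatureLike_curvatureTensor (p : M) : IsCurvatureLike (curvatureTensor g p) where
  add_left x x' y z w := by
    simp only [curvatureTensor_eq, map_add]
    exact (isCurvatureLike_localCurvature g p).add_left _ _ _ _ _
  swap_left x y z w := by
    simp only [curvatureTensor_eq]
    exact (isCurvatureLike_localCurvature g p).swap_left _ _ _ _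
  swap_right x y z w := by
    simp only [curvatureTensor_eq]
    exact (isCurvatureLike_localCurvature g p).swap_right _ _ _ _
  bianchi x y z w := by
    simp only [curvatureTensor_eq]
    exact (isCurvatureLike_localCurvature g p).bianchi _ _ _ _

theorem curvatureOperator_add_left (x x' y z : TangentSpace 𝓘(ℝ, E) p) :
    curvatureOperator g p (x + x') y z =
      curvatureOperator g p x y z + curvatureOperator g p x' y z :=
  eq_of_forall_inner g fun w ↦ by
    rw [map_add, add_apply]
    exact (isCurvatureLike_curvatureTensor g p).add_left x x' y z w

theorem curvatureOperator_swap (x y z : TangentSpace 𝓘(ℝ, E) p) :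
    curvatureOperator g p y x z = -curvatureOperator g p x y z :=
  eq_of_forall_inner g fun w ↦ by
    rw [map_neg, neg_apply]
    exact (isCurvatureLike_curvatureTensor g p).swap_left x y z w

theorem curvatureOperator_bianchi (x y z : TangentSpace 𝓘(ℝ, E) p) :
    curvatureOperator g p x y z + curvatureOperator g p y z x + curvatureOperator g p z x y = 0 :=
  eq_of_forall_inner g fun w ↦ by
    rw [map_add, map_add, map_zero]
    exact (isCurvatureLike_curvatureTensor g p).bianchi x y z w

theorem curvatureOperator_smul (a b c : ℝ) (x y z : TangentSpace 𝓘(ℝ, E) p) :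
    curvatureOperator g p (a • x) (b • y) (c • z) = (a * b * c) • curvatureOperator g p x y z := by
  apply (dChart_isInvertible (chart_mem_atlas E p) (mem_chart_source E p)).injective
  have hG := isLocalMetric_chart (chart_mem_atlas E p) g
  rw [map_smul]
  simp only [dChart_curvatureOperator, hG.localCurvature_eq (mem_chart_target E p),
    connCurvature, map_smul, smul_apply]
  module

variable {g}

theorem IsAlmostKahler.localCovDeriv_eq_zero (h : IsAlmostKahler g J)
    (hg : ∀ x y : TangentSpace 𝓘(ℝ, E) p,
      grayPart (J.toFun p : TangentSpace 𝓘(ℝ, E) p →+ TangentSpace 𝓘(ℝ, E) p)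
        (curvatureTensor g p) x y x y = 0) (x y : E) :
    localCovDeriv (metricIn g (chartAt E p)) (complexIn J (chartAt E p)) (chartAt E p p) x y = 0 := by
  have hs := mem_chart_source E p
  have ha := chart_mem_atlas E p
  refine (isLocalHermitian_chart ha g J h.1).localCovDeriv_eq_zero (mem_chart_target E p)
    (fun a hat x y z ↦ ?_) (fun x y ↦ ?_) x y
  · rw [← h.2 _ ha a hat x y z]
    exact (localExtDeriv_congr (chartAt E p).open_target hat
      (fun b hb x y ↦ kahlerFormIn_eq g ha hb x y) x y z).symm
  · obtain ⟨x', rfl⟩ := (dChart_isInvertible ha hs).bijective.surjective x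
    obtain ⟨y', rfl⟩ := (dChart_isInvertible ha hs).bijective.surjective y
    rw [← hg x' y']
    simp only [grayPart, AddMonoidHom.coe_coe, complexIn_dChart ha J hs, curvatureTensor_eq]

/-- An almost Kähler manifold is Kähler if the component of type
`((1, 0), (1, 0), (0, 1), (0, 1))` of its curvature vanishes. -/
theorem IsAlmostKahler.isKahler (h : IsAlmostKahler g J)
    (hg : ∀ (p : M) (x y : TangentSpace 𝓘(ℝ, E) p),
      grayPart (J.toFun p : TangentSpace 𝓘(ℝ, E) p →+ TangentSpace 𝓘(ℝ, E) p)
        (curvatureTensor g p) x y x y = 0) : IsKahler g J :=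
  ⟨h.1, fun e he u hu ↦ localCovDeriv_transition he (chart_mem_atlas E (e.symm u)) h.1 hu
    (mem_chart_source E (e.symm u)) (h.localCovDeriv_eq_zero (hg _))⟩

theorem IsKahler.curvatureOperator_complex (h : IsKahler g J) (x y z : TangentSpace 𝓘(ℝ, E) p) :
    curvatureOperator g p x y (J.toFun p z) = J.toFun p (curvatureOperator g p x y z) := by
  have hs := mem_chart_source E p
  have ha := chart_mem_atlas E p
  apply (dChart_isInvertible ha hs).injective
  rw [dChart_curvatureOperator, ← complexIn_dChart ha J hs, ← complexIn_dChart ha J hs,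
    dChart_curvatureOperator]
  exact (isLocalHermitian_chart ha g J h.1).localCurvature_complex (mem_chart_target E p)
    (h.2 _ ha) _ _ _

theorem IsKahler.isInvariantRight (h : IsKahler g J) (p : M) :
    IsInvariantRight (J.toFun p : TangentSpace 𝓘(ℝ, E) p →+ TangentSpace 𝓘(ℝ, E) p)
      (curvatureTensor g p) := fun x y z w ↦ by
  simp only [curvatureTensor, AddMonoidHom.coe_coe, h.curvatureOperator_complex, h.1 p]

theorem IsKahler.curvatureOperator_left (h : IsKahler g J) (x y z : TangentSpace 𝓘(ℝ, E) p) :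
    curvatureOperator g p (J.toFun p x) (J.toFun p y) z = curvatureOperator g p x y z :=
  eq_of_forall_inner g fun w ↦
    (h.isInvariantRight p).left (isCurvatureLike_curvatureTensor g p) x y z w

end Curvature

/-! ### Comparing two curvatures -/

section Comparison

variable {V : Type*} [AddCommGroup V]

theorem grayPart_eq_add_sub (J : V →+ V) (T T' : V → V → V → V → ℝ) (x y z w : V) :
    grayPart J T x y z w =
      grayPart J (fun x y z w ↦ T x y z w - T' x y z w) x y z w + grayPart J T' x y z w := by
  simp only [grayPart]
  ring

/-- Under `J`-invariance in the first pair, the cross terms of `T(x + Jy, J(x + Jy))` add up to `-2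
T(x, y)`, so skewness on pairs `(x, Jx)` spreads to all pairs. -/
theorem isCurvatureLike_of_skew_apply_self {J : V →+ V} {T : V → V → V → V → ℝ}
    (hJ : ∀ x, J (J x) = -x)
    (add_left : ∀ x x' y z w, T (x + x') y z w = T x y z w + T x' y z w)
    (swap_left : ∀ x y z w, T y x z w = -T x y z w)
    (bianchi : ∀ x y z w, T x y z w + T y z x w + T z x y w = 0)
    (inv : ∀ x y z w, T (J x) (J y) z w = T x y z w)
    (skew : ∀ x z w, T x (J x) w z = -T x (J x) z w) : IsCurvatureLike T where
  add_left := add_left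
  swap_left := swap_left
  bianchi := bianchi
  swap_right x y z w := by
    have add_snd : ∀ x y y' z w, T x (y + y') z w = T x y z w + T x y' z w := fun x y y' z w ↦ by
      rw [swap_left (y + y'), add_left, swap_left x y, swap_left x y']
      ring
    have neg_snd : ∀ x y z w, T x (-y) z w = -T x y z w := fun x y z w ↦ by
      have h0 := add_snd x 0 0 z w
      have h1 := add_snd x y (-y) z w
      simp only [add_neg_cancel, add_zero] at h0 h1
      linarith
    have h1 := skew (x + J y) z w
    have h2 := skew (J y) z w
    simp only [map_add, hJ, add_left, add_snd, neg_snd] at h1 h2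
    rw [swap_left (J x) (J y), swap_left (J x) (J y), inv, inv] at h1
    linarith [skew x z w]

end Comparison

/-! ### From complex lines to the full curvature -/

section Main

variable {E : Type*} [NormedAddCommGroup E] [NormedSpace ℝ E]
  {M : Type*} [TopologicalSpace M] [ChartedSpace E M] [IsManifold 𝓘(ℝ, E) ∞ M]
  {g g' : Metric E M} {J : AlmostComplex E M}

/-- The almost complex structure at a point, as an additive map. -/
def AlmostComplex.addHom (J : AlmostComplex E M) (p : M) :
    TangentSpace 𝓘(ℝ, E) p →+ TangentSpace 𝓘(ℝ, E) p := (J.toFun p : _ →+ _)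

theorem isComplexLine_span (h : IsAlmostHermitian g J) {p : M} {x : TangentSpace 𝓘(ℝ, E) p}
    (hx : x ≠ 0) : IsComplexLine J p (Submodule.span ℝ {x, J.toFun p x}) := by
  -- Orthogonality of `x` and `J x` gives their independence.
  have ho : g.inner p x (J.toFun p x) = 0 := by
    have h1 := h p x (J.toFun p x)
    rw [J.apply_apply, map_neg, g.symm] at h1
    linarith
  have hpos := g.pos p x hx
  have hli : LinearIndependent ℝ ![x, J.toFun p x] := by
    refine LinearIndependent.pair_iff.2 fun a b hab ↦ ?_
    have h1 := congrArg (g.inner p x) hab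
    have h2 := congrArg (g.inner p (J.toFun p x)) hab
    simp only [map_add, map_smul, map_zero, ho, h p x x, g.symm p (J.toFun p x) x, smul_eq_mul,
      mul_zero, add_zero, zero_add, mul_eq_zero, hpos.ne', or_false] at h1 h2
    exact ⟨h1, h2⟩
  refine ⟨?_, ?_⟩
  · have := finrank_span_eq_card hli
    rw [Matrix.range_cons_cons_empty] at this
    simpa using this
  · rw [Submodule.map_span]
    refine le_antisymm (Submodule.span_le.2 ?_) (Submodule.span_le.2 ?_)
    · rintro _ ⟨y, hy, rfl⟩
      rcases hy with rfl | rfl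
      · exact Submodule.subset_span (by simp)
      · have : J.toFun p (J.toFun p x) = -x := J.apply_apply p x
        change J.toFun p (J.toFun p x) ∈ _
        rw [this]
        exact Submodule.neg_mem _ (Submodule.subset_span (by simp))
    · rintro y (rfl | rfl)
      · have h1 : J.toFun p (J.toFun p y) ∈
            Submodule.span ℝ ((J.toFun p : TangentSpace 𝓘(ℝ, E) p →ₗ[ℝ] _) '' {y, J.toFun p y}) :=
          Submodule.subset_span ⟨J.toFun p y, by simp, rfl⟩
        rw [J.apply_apply] at h1
        simpa using Submodule.neg_mem _ h1
      · exact Submodule.subset_span ⟨x, by simp, rfl⟩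

/-- A homogeneous condition on tangent vectors holds if it holds for unit vectors of complex
lines. -/
theorem forall_of_forall_isComplexLine (h : IsAlmostHermitian g J)
    {P : ∀ p : M, TangentSpace 𝓘(ℝ, E) p → Prop}
    (hP : ∀ (p : M) (L : Submodule ℝ (TangentSpace 𝓘(ℝ, E) p)), IsComplexLine J p L →
      ∀ x ∈ L, g.inner p x x = 1 → P p x)
    (h0 : ∀ p, P p 0) (hs : ∀ p (c : ℝ) x, P p x → P p (c • x)) (p : M)
    (x : TangentSpace 𝓘(ℝ, E) p) : P p x := by
  by_cases hx : x = 0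
  · exact hx ▸ h0 p
  have hpos := g.pos p x hx
  set c := Real.sqrt (g.inner p x x) with hc
  have hc0 : 0 < c := Real.sqrt_pos.2 hpos
  have hcc : c * c = g.inner p x x := Real.mul_self_sqrt hpos.le
  have := hs p c (c⁻¹ • x) (hP p _ (isComplexLine_span h hx) _
    (Submodule.smul_mem _ _ (Submodule.subset_span (by simp))) ?_)
  · rwa [smul_inv_smul₀ hc0.ne'] at this
  · simp only [map_smul, smul_apply, smul_eq_mul, ← hcc]
    field_simp

theorem inner_complexJacobiOperator (g : Metric E M) {p : M} (x y z : TangentSpace 𝓘(ℝ, E) p) :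
    g.inner p (complexJacobiOperator g J p x y) z = curvatureTensor g p y x x z +
      curvatureTensor g p y (J.toFun p x) (J.toFun p x) z := by
  rw [complexJacobiOperator, map_add, add_apply]
  rfl

theorem lower_injective {R R' : ∀ p : M, TangentSpace 𝓘(ℝ, E) p → TangentSpace 𝓘(ℝ, E) p →
    TangentSpace 𝓘(ℝ, E) p → TangentSpace 𝓘(ℝ, E) p}
    (h : ∀ p, (fun x y z w ↦ g.inner p (R p x y z) w) = fun x y z w ↦ g.inner p (R' p x y z) w)
    (p : M) : R p = R' p := by
  funext x y z
  exact eq_of_forall_inner g fun w ↦ congrFun (congrFun (congrFun (congrFun (h p) x) y) z) w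

variable [FiniteDimensional ℝ E]

theorem complexCurvatureOperator_smul (g : Metric E M) {p : M} (c : ℝ)
    (x z : TangentSpace 𝓘(ℝ, E) p) :
    complexCurvatureOperator g J p (c • x) z = (c * c) • complexCurvatureOperator g J p x z := by
  have := curvatureOperator_smul g c c 1 x (J.toFun p x) z
  rwa [one_smul, mul_one, ← map_smul] at this

theorem complexJacobiOperator_smul (g : Metric E M) {p : M} (c : ℝ)
    (x y : TangentSpace 𝓘(ℝ, E) p) :
    complexJacobiOperator g J p (c • x) y = (c * c) • complexJacobiOperator g J p x y := by
  have h1 := curvatureOperator_smul g 1 c c y x x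
  have h2 := curvatureOperator_smul g 1 c c y (J.toFun p x) (J.toFun p x)
  rw [one_smul, one_mul] at h1 h2
  rw [complexJacobiOperator, complexJacobiOperator, jacobiOperator, jacobiOperator, map_smul, h1,
    h2, smul_add]
  rfl

theorem SameComplexCurvatureOperator.eq (h : SameComplexCurvatureOperator g g' J)
    (hg : IsAlmostHermitian g J) (p : M) (x z : TangentSpace 𝓘(ℝ, E) p) :
    complexCurvatureOperator g J p x z = complexCurvatureOperator g' J p x z := by
  refine forall_of_forall_isComplexLine hg (P := fun p x ↦ ∀ z, complexCurvatureOperator g J p x z =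
    complexCurvatureOperator g' J p x z) (fun p L hL x hx h1 z ↦ congrFun (h p L hL x hx h1) z)
    (fun p z ↦ ?_) (fun p c x hx z ↦ ?_) p x z
  · have h1 := complexCurvatureOperator_smul (J := J) g 0 0 z
    have h2 := complexCurvatureOperator_smul (J := J) g' 0 0 z
    simp only [mul_zero, zero_smul] at h1 h2
    rw [h1, h2]
  · rw [complexCurvatureOperator_smul, complexCurvatureOperator_smul, hx]

theorem SameComplexJacobiOperator.eq (h : SameComplexJacobiOperator g g' J)
    (hg : IsAlmostHermitian g J) (p : M) (x z : TangentSpace 𝓘(ℝ, E) p) :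
    complexJacobiOperator g J p x z = complexJacobiOperator g' J p x z := by
  refine forall_of_forall_isComplexLine hg (P := fun p x ↦ ∀ z, complexJacobiOperator g J p x z =
    complexJacobiOperator g' J p x z) (fun p L hL x hx h1 z ↦ congrFun (h p L hL x hx h1) z)
    (fun p z ↦ ?_) (fun p c x hx z ↦ ?_) p x z
  · have h1 := complexJacobiOperator_smul (J := J) g 0 0 z
    have h2 := complexJacobiOperator_smul (J := J) g' 0 0 z
    simp only [mul_zero, zero_smul] at h1 h2
    rw [h1, h2]
  · rw [complexJacobiOperator_smul, complexJacobiOperator_smul, hx]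

theorem SameComplexCurvatureForm.eq (h : SameComplexCurvatureForm g g' J)
    (hg : IsAlmostHermitian g J) (p : M) (x z w : TangentSpace 𝓘(ℝ, E) p) :
    g.inner p (complexCurvatureOperator g J p x z) w =
      g'.inner p (complexCurvatureOperator g' J p x z) w := by
  refine forall_of_forall_isComplexLine hg
    (P := fun p x ↦ ∀ z w, g.inner p (complexCurvatureOperator g J p x z) w =
      g'.inner p (complexCurvatureOperator g' J p x z) w) h (fun p z w ↦ ?_)
    (fun p c x hx z w ↦ ?_) p x z w
  · have h1 := complexCurvatureOperator_smul (J := J) g 0 0 z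
    have h2 := complexCurvatureOperator_smul (J := J) g' 0 0 z
    simp only [mul_zero, zero_smul] at h1 h2
    rw [h1, h2, map_zero, map_zero, zero_apply]
  · rw [complexCurvatureOperator_smul, complexCurvatureOperator_smul, map_smul, map_smul,
      smul_apply, smul_apply, hx]

theorem SameComplexJacobiForm.eq (h : SameComplexJacobiForm g g' J)
    (hg : IsAlmostHermitian g J) (p : M) (x y z : TangentSpace 𝓘(ℝ, E) p) :
    g.inner p (complexJacobiOperator g J p x y) z =
      g'.inner p (complexJacobiOperator g' J p x y) z := by
  refine forall_of_forall_isComplexLine hg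
    (P := fun p x ↦ ∀ y z, g.inner p (complexJacobiOperator g J p x y) z =
      g'.inner p (complexJacobiOperator g' J p x y) z) h (fun p z w ↦ ?_)
    (fun p c x hx z w ↦ ?_) p x y z
  · have h1 := complexJacobiOperator_smul (J := J) g 0 0 z
    have h2 := complexJacobiOperator_smul (J := J) g' 0 0 z
    simp only [mul_zero, zero_smul] at h1 h2
    rw [h1, h2, map_zero, map_zero, zero_apply]
  · rw [complexJacobiOperator_smul, complexJacobiOperator_smul, map_smul, map_smul,
      smul_apply, smul_apply, hx]

/-- An almost Kähler metric is Kähler, with curvature `T`, if its curvature agrees on complex lines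
with a tensor `T` that has the symmetries of a Kähler curvature tensor. -/
theorem IsAlmostKahler.curvatureTensor_eq_of_complexLine (hg : IsAlmostKahler g J)
    {T : ∀ p : M, TangentSpace 𝓘(ℝ, E) p → TangentSpace 𝓘(ℝ, E) p → TangentSpace 𝓘(ℝ, E) p →
      TangentSpace 𝓘(ℝ, E) p → ℝ} (hT : ∀ p, IsCurvatureLike (T p))
    (hi : ∀ p, IsInvariantRight (J.addHom p) (T p))
    (h : (∀ p x z w, curvatureTensor g p x (J.toFun p x) z w = T p x (J.toFun p x) z w) ∨
      ∀ p x y z, curvatureTensor g p y x x z + curvatureTensor g p y (J.toFun p x) (J.toFun p x) z =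
        T p y x x z + T p y (J.toFun p x) (J.toFun p x) z) :
    IsKahler g J ∧ ∀ p, curvatureTensor g p = T p := by
  have hJ : ∀ p x, J.addHom p (J.addHom p x) = -x := J.apply_apply
  have hD := fun p ↦ (isCurvatureLike_curvatureTensor g p).sub (hT p)
  have hK : IsKahler g J := hg.isKahler fun p x y ↦ by
    have h1 := grayPart_eq_zero_of_invariant (hJ p) (hT p) (hi p) x y x y
    refine (grayPart_eq_add_sub (J.addHom p) _ (T p) x y x y).trans ?_
    rw [h1, add_zero]
    rcases h with h | h
    · exact grayPart_eq_zero_of_apply_self (hJ p) (hD p) (fun x z w ↦ sub_eq_zero.2 (h p x z w)) _ _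
        _ _
    · refine grayPart_eq_zero_of_jacobi (hJ p) (hD p) (fun x y z ↦ ?_) _ _ _ _
      have := h p x y z
      change curvatureTensor g p y x x z - T p y x x z +
        (curvatureTensor g p y (J.toFun p x) (J.toFun p x) z - T p y (J.toFun p x) (J.toFun p x) z)
          = 0
      linarith
  refine ⟨hK, fun p ↦ ?_⟩
  -- Available only now that `g` is known to be Kähler.
  have hDi : IsInvariantRight (J.addHom p) (fun x y z w ↦ curvatureTensor g p x y z w - T p x y z w) :=
    fun x y z w ↦ congrArg₂ (· - ·) (hK.isInvariantRight p x y z w) (hi p x y z w)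
  have hself : ∀ x z w, curvatureTensor g p x (J.addHom p x) z w - T p x (J.addHom p x) z w = 0 := by
    rcases h with h | h
    · exact fun x z w ↦ sub_eq_zero.2 (h p x z w)
    · refine apply_self_eq_zero_of_jacobi (hJ p) (hD p) hDi fun x y z ↦ ?_
      have := h p x y z
      change curvatureTensor g p y x x z - T p y x x z +
        (curvatureTensor g p y (J.toFun p x) (J.toFun p x) z - T p y (J.toFun p x) (J.toFun p x) z)
          = 0
      linarith
  funext x y z w
  exact sub_eq_zero.1 (eq_zero_of_invariant_of_apply_self (hJ p) (hD p) hDi hself x y z w)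

/-- The curvature operator of a Kähler metric `g'`, lowered by another Hermitian metric `g`, is a
curvature tensor if `𝓡'(x, J x)` is always skew with respect to `g`. -/
theorem IsKahler.isCurvatureLike_lower (hg' : IsKahler g' J) {p : M}
    (skew : ∀ x z w : TangentSpace 𝓘(ℝ, E) p,
      g.inner p (complexCurvatureOperator g' J p x w) z =
        -g.inner p (complexCurvatureOperator g' J p x z) w) :
    IsCurvatureLike (fun x y z w ↦ g.inner p (curvatureOperator g' p x y z) w) := by
  refine isCurvatureLike_of_skew_apply_self (J := J.addHom p) (J.apply_apply p)
    (fun x x' y z w ↦ ?_) (fun x y z w ↦ ?_) (fun x y z w ↦ ?_) (fun x y z w ↦ ?_) skew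
  · rw [curvatureOperator_add_left, map_add, add_apply]
  · rw [curvatureOperator_swap, map_neg, neg_apply]
  · rw [← add_apply, ← add_apply, ← map_add, ← map_add, curvatureOperator_bianchi, map_zero,
      zero_apply]
  · exact congrArg (g.inner p · w) (hg'.curvatureOperator_left x y z)

theorem IsKahler.isInvariantRight_lower (hg : IsAlmostHermitian g J) (hg' : IsKahler g' J) (p : M) :
    IsInvariantRight (J.addHom p) (fun x y z w ↦ g.inner p (curvatureOperator g' p x y z) w) :=
  fun x y z w ↦ by
    change g.inner p (curvatureOperator g' p x y (J.toFun p z)) (J.toFun p w) = _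
    rw [hg'.curvatureOperator_complex, hg]

/-- On a Kähler manifold the complex Jacobi operator is `J 𝓡(x, J x)`. -/
theorem IsKahler.complexJacobiOperator_eq (hg : IsKahler g J) {p : M}
    (x y : TangentSpace 𝓘(ℝ, E) p) :
    complexJacobiOperator g J p x y = J.toFun p (complexCurvatureOperator g J p x y) := by
  have h1 := congrArg (J.toFun p) (curvatureOperator_bianchi g y (J.toFun p x) x)
  rw [map_add, map_add, map_zero, curvatureOperator_swap g x (J.toFun p x),
    ← hg.curvatureOperator_complex y, ← hg.curvatureOperator_complex x y,
    hg.curvatureOperator_complex x y, hg.curvatureOperator_complex x y, J.apply_apply,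
    curvatureOperator_swap g y x] at h1
  rw [complexJacobiOperator, jacobiOperator, jacobiOperator, complexCurvatureOperator]
  rw [map_neg] at h1
  rw [← sub_eq_zero, ← h1]
  abel

/-- The comparison tensor is the operator of `g'` lowered with `g`; on pairs `(x, J x)` it equals
the curvature of `g`, which supplies the missing skewness. -/
theorem SameComplexCurvatureOperator.curvatureOperator_eq (h : SameComplexCurvatureOperator g g' J)
    (hg : IsAlmostKahler g J) (hg' : IsKahler g' J) :
    IsKahler g J ∧ ∀ p : M, curvatureOperator g p = curvatureOperator g' p := by
  have e := h.eq hg.1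
  have := hg.curvatureTensor_eq_of_complexLine
    (T := fun p x y z w ↦ g.inner p (curvatureOperator g' p x y z) w)
    (fun p ↦ hg'.isCurvatureLike_lower fun x z w ↦ ?_)
    (fun p ↦ hg'.isInvariantRight_lower hg.1 p) (.inl fun p x z w ↦ ?_)
  · exact ⟨this.1, lower_injective this.2⟩
  · rw [← e, ← e]
    exact (isCurvatureLike_curvatureTensor g p).swap_right _ _ _ _
  · exact congrArg (g.inner p · w) (e p x z)

theorem SameComplexJacobiOperator.curvatureOperator_eq (h : SameComplexJacobiOperator g g' J)
    (hg : IsAlmostKahler g J) (hg' : IsKahler g' J) :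
    IsKahler g J ∧ ∀ p : M, curvatureOperator g p = curvatureOperator g' p := by
  have e := h.eq hg.1
  have := hg.curvatureTensor_eq_of_complexLine
    (T := fun p x y z w ↦ g.inner p (curvatureOperator g' p x y z) w)
    (fun p ↦ hg'.isCurvatureLike_lower fun x z w ↦ ?_)
    (fun p ↦ hg'.isInvariantRight_lower hg.1 p) (.inr fun p x y z ↦ ?_)
  · exact ⟨this.1, lower_injective this.2⟩
  · have hR := isCurvatureLike_curvatureTensor g p
    -- The complex Jacobi operator of `g` is `g`-symmetric, and by hypothesis it is also that of
    -- `g'`, namely `J A` with `A = 𝓡'(x, J x)` commuting with `J`. Symmetry of `J A`, tested on `z`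
    -- and `J w`, says that `A` is `g`-skew.
    have hs : ∀ y z, g.inner p (complexJacobiOperator g J p x y) z =
        g.inner p (complexJacobiOperator g J p x z) y := fun y z ↦ by
      have k : ∀ a, curvatureTensor g p y a a z = curvatureTensor g p z a a y := fun a ↦ by
        rw [hR.pair_symm a z y a, hR.swap_left z a, hR.swap_right z a a y, neg_neg]
      rw [inner_complexJacobiOperator, inner_complexJacobiOperator, k, k]
    have h1 := hs z (J.toFun p w)
    rw [e, e, hg'.complexJacobiOperator_eq, hg'.complexJacobiOperator_eq, hg.1,
      complexCurvatureOperator, complexCurvatureOperator, hg'.curvatureOperator_complex,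
      J.apply_apply, map_neg, neg_apply] at h1
    rw [complexCurvatureOperator, complexCurvatureOperator, h1, neg_neg]
  · rw [← inner_complexJacobiOperator, e, complexJacobiOperator, map_add, add_apply]
    rfl

/-- Each metric lowers its own curvature, so the comparison tensor has all the curvature symmetries
from the start. -/
theorem SameComplexCurvatureForm.curvatureTensor_eq (h : SameComplexCurvatureForm g g' J)
    (hg : IsAlmostKahler g J) (hg' : IsKahler g' J) :
    IsKahler g J ∧ ∀ p : M, curvatureTensor g p = curvatureTensor g' p :=
  hg.curvatureTensor_eq_of_complexLine (fun p ↦ isCurvatureLike_curvatureTensor g' p)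
    (fun p ↦ hg'.isInvariantRight p) (.inl fun p x z w ↦ h.eq hg.1 p x z w)

theorem SameComplexJacobiForm.curvatureTensor_eq (h : SameComplexJacobiForm g g' J)
    (hg : IsAlmostKahler g J) (hg' : IsKahler g' J) :
    IsKahler g J ∧ ∀ p : M, curvatureTensor g p = curvatureTensor g' p :=
  hg.curvatureTensor_eq_of_complexLine (fun p ↦ isCurvatureLike_curvatureTensor g' p)
    (fun p ↦ hg'.isInvariantRight p) (.inr fun p x y z ↦ by
      rw [← inner_complexJacobiOperator, ← inner_complexJacobiOperator, h.eq hg.1])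

end Main

end AlmostHermitian

end

theorem mainTheorem7 {E : Type*} [NormedAddCommGroup E] [NormedSpace ℝ E] [FiniteDimensional ℝ E]
    {M : Type*} [TopologicalSpace M] [ChartedSpace E M] [IsManifold 𝓘(ℝ, E) ∞ M]
    (g g' : AlmostHermitian.Metric E M) (J : AlmostHermitian.AlmostComplex E M)
    (hg : AlmostHermitian.IsAlmostKahler g J) (hg' : AlmostHermitian.IsKahler g' J) :
    ((AlmostHermitian.SameComplexCurvatureOperator g g' J ↔
        AlmostHermitian.SameComplexJacobiOperator g g' J) ∧
      (AlmostHermitian.SameComplexCurvatureOperator g g' J →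
        AlmostHermitian.IsKahler g J ∧
          ∀ p : M, AlmostHermitian.curvatureOperator g p =
            AlmostHermitian.curvatureOperator g' p)) ∧
    ((AlmostHermitian.SameComplexCurvatureForm g g' J ↔
        AlmostHermitian.SameComplexJacobiForm g g' J) ∧
      (AlmostHermitian.SameComplexCurvatureForm g g' J →
        AlmostHermitian.IsKahler g J ∧
          ∀ p : M, AlmostHermitian.curvatureTensor g p =
            AlmostHermitian.curvatureTensor g' p)) := by
  refine ⟨⟨⟨fun h p L _ x _ _ ↦ ?_, fun h p L _ x _ _ ↦ ?_⟩,
    fun h ↦ h.curvatureOperator_eq hg hg'⟩, ⟨fun h p L _ x _ _ y z ↦ ?_, fun h p L _ x _ _ z w ↦ ?_⟩,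
    fun h ↦ h.curvatureTensor_eq hg hg'⟩
  · have e := (h.curvatureOperator_eq hg hg').2 p
    funext y
    simp only [AlmostHermitian.complexJacobiOperator, AlmostHermitian.jacobiOperator, e]
  · have e := (h.curvatureOperator_eq hg hg').2 p
    funext y
    simp only [AlmostHermitian.complexCurvatureOperator, e]
  · rw [AlmostHermitian.inner_complexJacobiOperator, AlmostHermitian.inner_complexJacobiOperator,
      (h.curvatureTensor_eq hg hg').2 p]
  · exact congrFun (congrFun (congrFun (congrFun ((h.curvatureTensor_eq hg hg').2 p) x)
      (J.toFun p x)) z) w
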